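/- \textbf{Model.} Let $G=(V,E)$ be a connected undirected graph with $n\ge 3$ nodes and diameter $D$, and let $s\in V$ be the source. Nodes communicate in synchronized rounds $t=1,2,\dots$; in each round a node either broadcasts a packet or is silent. In the faultless model a node $v$ receives a packet from a neighbor if and only if $v$ is silent and exactly one neighbor of $v$ broadcasts. With \emph{sender faults}, each broadcasting node independently transmits noise instead of its packet with probability $p$ (it still collides with other broadcasts); with \emph{receiver faults}, each silent node with exactly one broadcasting neighbor independently receives noise with probability $p$. Noise is never mistaken for a packet. Initially only $s$ has the message, and nodes that do not have the message are silent. \textbf{GBST.} The level $\ell(v)$ of $v$ is its distance from $s$. A ranked BFS tree is a BFS tree of $G$ rooted at $s$ in which every leaf has rank $1$ and a non-leaf node whose children have maximum rank $r$ has rank $r$ if exactly one child has rank $r$, and rank $r+1$ otherwise. It is a gathering-broadcasting spanning tree (GBST) if, whenever $v\ne w$ have the same level and the same rank $r$, and their tree parents $v'\neq w'$ are distinct and both have rank $r$, then $G$ contains neither the edge $v'w$ nor the edge $w'v$. A node is fast if one of its children has the same rank as it. Let $r_{\max}$ be the largest rank. \textbf{Robust FASTBC.} Let $S=S(n)\ge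 1$ be an integer with $S=\Theta(\log\log n)$, let $L=L(n)\ge\lceil\log_2 n\rceil$ be an integer with $L=O(\log n)$, and let $c$ be a positive integer. Given a GBST of $(G,s)$, in each odd round $t$ every node that has the message broadcasts it, independently, with probability $2^{-(((t-1)/2) \bmod L)}$. In each even round $t$ a fast node of level $l$ and rank $r$ that has the message broadcasts it if $$\Big\lfloor \frac lS\Big\rfloor-6r\equiv\Big\lfloor\frac{t/2}{cS}\Big\rfloor \pmod{6r_{\max}}\quad\text{and}\quad l\equiv t\pmod 3,$$ and all other nodes are silent. \textbf{Theorem (Robust FASTBC).} Fix $p\in[0,1)$ and $S$, $L$ as above. There is a $c_0$ such that for every integer $c\ge c_0$ there is a constant $C>0$ (depending only on $p$, the functions $S$, $L$, and $c$) with the following property. For every connected graph $G$ with $n\ge 3$ nodes and diameter $D$ and every source $s$, a GBST exists, and for every GBST, for sender faults as well as for receiver faults with fault probability $p$, for every $\delta\in(0,1)$ and every integer $$N\ \ge\ C\Big(D+\log n\,\log\log n\,\big(\log n+\log\tfrac1\delta\big)\Big),$$ the probability that after $N$ rounds of Robust FASTBC some node does not have the message is at most $\delta$. -/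

import Mathlib

open Filter Asymptotics

namespace NoisyRadio

noncomputable section

/-! ### Noisy radio networks -/

/-- Which kind of random faults the network has. -/
inductive FaultModel
  | sender
  | receiver

section Network

variable {V : Type*}

/-- `Receives G M B F v`: node `v` receives the packet of a neighbour in a round in which exactly
the nodes in `B` broadcast and the nodes in `F` are hit by a fault. The node `v` has to be silent,
it has to have exactly one broadcasting neighbour `u`, and there must be no fault at `u` (sender
faults) respectively at `v` (receiver faults). A faulty sender transmits noise, so it
still collides with the other senders. -/
def Receives (G : SimpleGraph V) (M : FaultModel) (B F : Finset V) (v : V) : Prop :=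
  v ∉ B ∧ ∃ u, u ∈ B ∧ G.Adj u v ∧ (∀ w, w ∈ B → G.Adj w v → w = u) ∧
    match M with
    | FaultModel.sender => u ∉ F
    | FaultModel.receiver => v ∉ F

variable [Fintype V]

open scoped Classical in
/-- The informed nodes after a round with informed nodes `J`, broadcasting nodes `B` and
faults at `F`. -/
def nextInformed (G : SimpleGraph V) (M : FaultModel) (J B F : Finset V) : Finset V :=
  Finset.univ.filter fun v => v ∈ J ∨ Receives G M B F v

open scoped Classical in
/-- The probability of the outcome `A` for a random set of nodes which contains each node `v`
with probability `q v`, independently of the other nodes. -/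
def subsetWeight (q : V → unitInterval) (A : Finset V) : ENNReal :=
  (∏ v ∈ A, ENNReal.ofReal (q v : ℝ)) * ∏ v ∈ Aᶜ, ENNReal.ofReal (1 - (q v : ℝ))

theorem sum_subsetWeight (q : V → unitInterval) : ∑ A, subsetWeight q A = 1 := by
  classical
  have h : ∀ v, ENNReal.ofReal (q v : ℝ) + ENNReal.ofReal (1 - (q v : ℝ)) = 1 := fun v => by
    rw [← ENNReal.ofReal_add (q v).2.1 (sub_nonneg.2 (q v).2.2)]
    simp
  have h2 := Fintype.prod_add (fun v => ENNReal.ofReal (q v : ℝ))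
    (fun v => ENNReal.ofReal (1 - (q v : ℝ)))
  simp only [h, Finset.prod_const_one] at h2
  rw [h2]
  refine Finset.sum_congr rfl fun A _ => ?_
  unfold subsetWeight
  congr!

/-- A random set of nodes which contains each node `v` with probability `q v`, independently. -/
def randomSubset (q : V → unitInterval) : PMF (Finset V) :=
  PMF.ofFintype (subsetWeight q) (sum_subsetWeight q)

open scoped Classical in
/-- One round of a single-message routing protocol with current set `J` of informed nodes: each
node `v` in `J` broadcasts the message with probability `q v`, uninformed nodes are silent, and
there is a fault at each node with probability `p`; all these choices are independent. -/
def roundStep (G : SimpleGraph V) (M : FaultModel) (p : unitInterval) (q : V → unitInterval) (J : Finset V) :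
    PMF (Finset V) :=
  (randomSubset fun v => if v ∈ J then q v else 0).bind fun B =>
    (randomSubset fun _ => p).bind fun F =>
      PMF.pure (nextInformed G M J B F)

/-- The law of the set of informed nodes after the rounds `1, …, N`, if initially only the source
`s` is informed and in round `t` an informed node `v` broadcasts with probability `q t v`. -/
def informedAfter (G : SimpleGraph V) (M : FaultModel) (p : unitInterval) (q : ℕ → V → unitInterval) (s : V) :
    ℕ → PMF (Finset V)
  | 0 => PMF.pure {s}
  | N + 1 => (informedAfter G M p q s N).bind (roundStep G M p (q (N + 1)))

/-- The probability that after `N` rounds some node does not have the message. -/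
def failureProb (G : SimpleGraph V) (M : FaultModel) (p : unitInterval) (q : ℕ → V → unitInterval) (s : V) (N : ℕ) :
    ENNReal :=
  (informedAfter G M p q s N).toOuterMeasure {J | ∃ v, v ∉ J}

end Network

/-! ### Gathering-broadcasting spanning trees -/

section Trees

variable {V : Type*}

/-- The level of a node: its distance from the source. -/
def level (G : SimpleGraph V) (s v : V) : ℕ := G.dist s v

/-- A ranked breadth-first search tree of `G` rooted at `s`, given by the parent of every node
other than `s` (the value `parent s = s` is a convention) and by the ranks. -/
structure RankedBFSTree (G : SimpleGraph V) (s : V) where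
  parent : V → V
  rank : V → ℕ
  parent_root : parent s = s
  adj_parent : ∀ v, v ≠ s → G.Adj (parent v) v
  level_parent : ∀ v, v ≠ s → level G s v = level G s (parent v) + 1
  /-- Every leaf has rank `1`. -/
  rank_leaf : ∀ v, (∀ w, w ≠ s → parent w ≠ v) → rank v = 1
  /-- If exactly one child of `v` has the maximal rank `r` among the children of `v`, then `v` has
  rank `r`. -/
  rank_unique : ∀ v r, (∀ w, w ≠ s → parent w = v → rank w ≤ r) →
    (∃! w, w ≠ s ∧ parent w = v ∧ rank w = r) → rank v = r
  /-- If at least two children of `v` have the maximal rank `r`, then `v` has rank `r + 1`. -/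
  rank_multiple : ∀ v r, (∀ w, w ≠ s → parent w = v → rank w ≤ r) →
    (∃ w w', w ≠ w' ∧ (w ≠ s ∧ parent w = v ∧ rank w = r) ∧
      (w' ≠ s ∧ parent w' = v ∧ rank w' = r)) → rank v = r + 1

namespace RankedBFSTree

variable {G : SimpleGraph V} {s : V}

/-- `T` is a gathering-broadcasting spanning tree: if `v` and `w` are nodes of the same level and
the same rank `r` whose parents are distinct and both have rank `r`, then `G` has no edge between
the parent of one and the other (the case of `parent w` and `v` is the one with `v` and `w`
exchanged). -/
def IsGBST (T : RankedBFSTree G s) : Prop :=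
  ∀ v w, v ≠ s → w ≠ s → level G s v = level G s w → T.rank v = T.rank w →
    T.parent v ≠ T.parent w → T.rank (T.parent v) = T.rank v → T.rank (T.parent w) = T.rank w →
    ¬ G.Adj (T.parent v) w

/-- A node is fast if one of its children in the tree has the same rank. -/
def IsFast (T : RankedBFSTree G s) (u : V) : Prop :=
  ∃ w, w ≠ s ∧ T.parent w = u ∧ T.rank w = T.rank u

/-- The largest rank. -/
def maxRank [Fintype V] (T : RankedBFSTree G s) : ℕ := Finset.univ.sup T.rank

end RankedBFSTree

/-! ### Robust FASTBC -/

/-- The probability `1 / 2`. -/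
def half : unitInterval := ⟨1 / 2, by norm_num, by norm_num⟩

open scoped Classical in
/-- Robust FASTBC on the tree `T` with block size `S`, superround multiplier `c` and Decay phases
of length `L`: the probability with which the node `v` broadcasts in round `t = 1, 2, …` if it has
the message. Odd rounds are Decay steps. In even rounds, a fast node of level `l` and rank `r`
broadcasts (with probability one) if `⌊l / S⌋ - 6 r ≡ ⌊(t / 2) / (c S)⌋` modulo `6 r_max` and
`l ≡ t` modulo `3`. -/
def robustFASTBC [Fintype V] {G : SimpleGraph V} {s : V} (T : RankedBFSTree G s) (S c L : ℕ)
    (t : ℕ) (v : V) : unitInterval :=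
  if Odd t then half ^ ((t - 1) / 2 % L)
  else if T.IsFast v ∧
      ((level G s v / S : ℕ) : ℤ) - 6 * (T.rank v : ℤ) ≡ ((t / 2 / (c * S) : ℕ) : ℤ)
        [ZMOD 6 * (T.maxRank : ℤ)] ∧
      level G s v ≡ t [MOD 3] then 1
  else 0

end Trees

end

end NoisyRadio

/-!
Among all ranked BFS trees, one with the fewest distinct pairs (parent of a node, rank of the node),
comparing deeper levels first, is a GBST: if an edge violates the condition, then moving a node
along it to another parent merges two such pairs.

For a fixed node `v` the message is followed along the tree path from `s` to `v`. The rank never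
increases along this path, and it is at most about `log₂ n`. Where it drops, two Decay phases inform
the next node of the path with probability at least `(1 - p) / 16`. Where it stays constant, the
path consists of fast nodes; when their superround is active, the GBST condition and the levels
modulo `3` exclude collisions, so that the message crosses a whole block of `S` levels except with
probability `2 ^ S * ((1 + p) / 2) ^ ((c * S - 1) / 3)`, and the next block is active in the next
superround. This probability is a small multiple of `1 / log n` if `c` is large, because `S` is of
order `log log n`.

Hence the probability that `v` misses the message for `k` rounds is at most
`16 ^ rank * exp (6 * lam * c * S * blocks) * exp (-lam * k)` up to a constant factor, where
`blocks` counts the blocks that are left and `lam` is of order `1 / (log n * log log n)`: the factor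
`16` pays for waiting in front of a slow edge, and each superround spent on a fast stretch gains
more than the risk of its failure costs. Since `16 ^ rank` is polynomial in `n`, a union bound over
`v` finishes the proof.
-/

namespace NoisyRadio

noncomputable section

section Rank

variable {V : Type*} {ρ ρ' : V → ℕ} {A : Finset V}

open scoped Classical in
/-- The rank of a node with set of children `A`, where `ρ` gives the ranks of the children. -/
def nodeRank (ρ : V → ℕ) (A : Finset V) : ℕ :=
  if A = ∅ then 1 else if ∃! w, w ∈ A ∧ ρ w = A.sup ρ then A.sup ρ else A.sup ρ + 1

theorem nodeRank_empty : nodeRank ρ ∅ = 1 := if_pos rfl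

theorem nodeRank_congr (h : ∀ w ∈ A, ρ w = ρ' w) : nodeRank ρ A = nodeRank ρ' A := by
  classical
  have hsup : A.sup ρ = A.sup ρ' := Finset.sup_congr rfl h
  have hiff : (∃! w, w ∈ A ∧ ρ w = A.sup ρ') ↔ ∃! w, w ∈ A ∧ ρ' w = A.sup ρ' :=
    existsUnique_congr fun w => and_congr_right fun hw => by rw [h w hw]
  simp only [nodeRank, hsup, hiff]

theorem sup_le_nodeRank : A.sup ρ ≤ nodeRank ρ A := by
  unfold nodeRank
  split_ifs with h
  · simp [h]
  · exact le_rfl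
  · exact Nat.le_succ _

theorem le_nodeRank {w : V} (hw : w ∈ A) : ρ w ≤ nodeRank ρ A :=
  (Finset.le_sup hw).trans sup_le_nodeRank

theorem nodeRank_of_existsUnique {r : ℕ} (hle : ∀ w ∈ A, ρ w ≤ r)
    (h : ∃! w, w ∈ A ∧ ρ w = r) : nodeRank ρ A = r := by
  obtain ⟨w, hwA, hwr⟩ := h.exists
  have hsup : A.sup ρ = r := le_antisymm (Finset.sup_le hle) (hwr ▸ Finset.le_sup hwA)
  rw [nodeRank, if_neg (Finset.ne_empty_of_mem hwA), hsup, if_pos h]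

theorem nodeRank_of_ne {r : ℕ} {w w' : V} (hle : ∀ w ∈ A, ρ w ≤ r) (hne : w ≠ w')
    (hw : w ∈ A) (hwr : ρ w = r) (hw' : w' ∈ A) (hwr' : ρ w' = r) : nodeRank ρ A = r + 1 := by
  have hsup : A.sup ρ = r := le_antisymm (Finset.sup_le hle) (hwr ▸ Finset.le_sup hw)
  rw [nodeRank, if_neg (Finset.ne_empty_of_mem hw), hsup, if_neg]
  exact fun h => hne (h.unique ⟨hw, hwr⟩ ⟨hw', hwr'⟩)

theorem nodeRank_cases (ρ : V → ℕ) (A : Finset V) : A = ∅ ∨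
    ∃ r, (∀ w ∈ A, ρ w ≤ r) ∧ ((∃! w, w ∈ A ∧ ρ w = r) ∨
      ∃ w w', w ≠ w' ∧ (w ∈ A ∧ ρ w = r) ∧ (w' ∈ A ∧ ρ w' = r)) := by
  refine A.eq_empty_or_nonempty.imp_right fun hA => ?_
  obtain ⟨w, hw, hmax⟩ := A.exists_max_image ρ hA
  refine ⟨ρ w, hmax, ?_⟩
  by_cases hw' : ∃ w', w ≠ w' ∧ w' ∈ A ∧ ρ w' = ρ w
  · obtain ⟨w', hne, hw'⟩ := hw'
    exact Or.inr ⟨w, w', hne, ⟨hw, rfl⟩, hw'⟩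
  · refine Or.inl ⟨w, ⟨hw, rfl⟩, fun y hy => ?_⟩
    by_contra hne
    exact hw' ⟨y, Ne.symm hne, hy⟩

theorem nodeRank_pos (h : ∀ w ∈ A, 1 ≤ ρ w) : 1 ≤ nodeRank ρ A := by
  rcases A.eq_empty_or_nonempty with rfl | ⟨w, hw⟩
  · exact nodeRank_empty.ge
  · exact (h w hw).trans (le_nodeRank hw)

theorem two_pow_nodeRank_le :
    2 ^ (nodeRank ρ A - 1) ≤ 1 + ∑ w ∈ A, 2 ^ (ρ w - 1) := by
  classical
  rcases nodeRank_cases ρ A with rfl | ⟨r, hle, h | ⟨w, w', hne, ⟨hw, hwr⟩, hw', hwr'⟩⟩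
  · simp [nodeRank_empty]
  · obtain ⟨w, hw, hwr⟩ := h.exists
    rw [nodeRank_of_existsUnique hle h, ← hwr]
    exact (Finset.single_le_sum (f := fun w => 2 ^ (ρ w - 1)) (fun _ _ => Nat.zero_le _)
      hw).trans (Nat.le_add_left _ _)
  · have hpair : 2 ^ (r - 1) + 2 ^ (r - 1) ≤ ∑ w ∈ A, 2 ^ (ρ w - 1) := by
      have hsub : ({w, w'} : Finset V) ⊆ A :=
        Finset.insert_subset hw (Finset.singleton_subset_iff.2 hw')
      have := Finset.sum_le_sum_of_subset (f := fun w => 2 ^ (ρ w - 1)) hsub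
      rwa [Finset.sum_pair hne, hwr, hwr'] at this
    rw [nodeRank_of_ne hle hne hw hwr hw' hwr', Nat.add_sub_cancel]
    rcases r with _ | r
    · simp
    · rw [Nat.add_sub_cancel] at hpair
      rw [pow_succ]
      omega

theorem exists_eq_nodeRank {child : V → Finset V}
    (hwf : WellFounded fun w v => w ∈ child v) : ∃ ρ : V → ℕ, ∀ v, ρ v = nodeRank ρ (child v) := by
  classical
  let ρ : V → ℕ := hwf.fix fun v ih => nodeRank (fun w => if h : w ∈ child v then ih w h else 0)
    (child v)
  refine ⟨ρ, fun v => (hwf.fix_eq _ v).trans (nodeRank_congr fun w hw => ?_)⟩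
  exact dif_pos hw

end Rank

section Level

variable {V : Type*} {G : SimpleGraph V} {s : V}

theorem exists_adj_level (hG : G.Connected) {v : V} (hv : v ≠ s) :
    ∃ u, G.Adj u v ∧ level G s v = level G s u + 1 := by
  obtain ⟨P, hP⟩ := hG.exists_walk_length_eq_dist v s
  cases P with
  | nil => exact absurd rfl hv
  | @cons _ u _ h P' =>
    have hu : G.dist u s ≤ P'.length := SimpleGraph.dist_le P'
    have hvu := hG.dist_triangle (u := v) (v := u) (w := s)
    rw [SimpleGraph.dist_eq_one_iff_adj.2 h] at hvu
    rw [SimpleGraph.Walk.length_cons] at hP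
    refine ⟨u, h.symm, ?_⟩
    simp only [level, SimpleGraph.dist_comm (u := s)]
    omega

theorem level_lt_card [Fintype V] (v : V) : level G s v < Fintype.card V := by
  by_cases h : G.Reachable s v
  · obtain ⟨P, hP, hlen⟩ := h.exists_path_of_dist
    exact hlen.symm.trans_lt hP.length_lt
  · rw [level, SimpleGraph.dist_eq_zero_of_not_reachable h]
    exact Fintype.card_pos_iff.2 ⟨s⟩

end Level

namespace RankedBFSTree

open scoped Finset

variable {V : Type*} {G : SimpleGraph V} {s : V}

section Children

variable [Finite V] (T : RankedBFSTree G s)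

/-- The children of a node, as a finset so that `nodeRank` applies to it. -/
def children (v : V) : Finset V := (Set.toFinite {w | w ≠ s ∧ T.parent w = v}).toFinset

variable {T}

theorem mem_children {v w : V} : w ∈ T.children v ↔ w ≠ s ∧ T.parent w = v := by
  simp [children]

theorem level_of_mem_children {v w : V} (h : w ∈ T.children v) :
    level G s w = level G s v + 1 := by
  obtain ⟨hw, rfl⟩ := mem_children.1 h
  exact T.level_parent w hw

variable (T)

theorem rank_eq_nodeRank (v : V) : T.rank v = nodeRank T.rank (T.children v) := by
  have hall {P : V → Prop} : (∀ w, w ≠ s → T.parent w = v → P w) ↔ ∀ w ∈ T.children v, P w := by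
    simp only [mem_children, and_imp]
  rcases nodeRank_cases T.rank (T.children v) with h | ⟨r, hle, h | ⟨w, w', hne, hw, hw'⟩⟩
  · rw [h, nodeRank_empty]
    refine T.rank_leaf v fun w hw hwv => ?_
    have := mem_children.2 ⟨hw, hwv⟩
    simp [h] at this
  · rw [nodeRank_of_existsUnique hle h]
    exact T.rank_unique v r (hall.2 hle) (by simpa only [mem_children, and_assoc] using h)
  · rw [nodeRank_of_ne hle hne hw.1 hw.2 hw'.1 hw'.2]
    refine T.rank_multiple v r (hall.2 hle) ⟨w, w', hne, ?_, ?_⟩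
    · simpa only [mem_children, and_assoc] using hw
    · simpa only [mem_children, and_assoc] using hw'

theorem wellFounded_of_level {child : V → Finset V}
    (h : ∀ v, ∀ w ∈ child v, level G s w = level G s v + 1) :
    WellFounded fun w v => w ∈ child v := by
  have hwf : WellFounded fun w v : V => level G s v < level G s w :=
    @Finite.wellFounded_of_trans_of_irrefl V _ _ ⟨fun _ _ _ h₁ h₂ => h₂.trans h₁⟩
      ⟨fun _ => lt_irrefl _⟩
  exact Subrelation.wf (fun {w v} hw => by have := h v w hw; omega) hwf

theorem children_induction {P : V → Prop} (h : ∀ v, (∀ w ∈ T.children v, P w) → P v) (v : V) :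
    P v :=
  (wellFounded_of_level fun _ _ => T.level_of_mem_children).induction v h

theorem one_le_rank (v : V) : 1 ≤ T.rank v := by
  induction v using T.children_induction with
  | h v ih => exact T.rank_eq_nodeRank v ▸ nodeRank_pos ih

theorem rank_le_rank_parent (v : V) : T.rank v ≤ T.rank (T.parent v) := by
  rcases eq_or_ne v s with rfl | hv
  · rw [T.parent_root]
  · rw [T.rank_eq_nodeRank (T.parent v)]
    exact le_nodeRank (mem_children.2 ⟨hv, rfl⟩)

theorem rank_eq_of_parent_eq {T T' : RankedBFSTree G s} {l : ℕ}
    (h : ∀ v, l < level G s v → T.parent v = T'.parent v) (v : V) (hv : l ≤ level G s v) :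
    T.rank v = T'.rank v := by
  induction v using T.children_induction with
  | h v ih =>
    have hch : T.children v = T'.children v := by
      ext w
      simp only [mem_children]
      refine and_congr_right fun hw => ⟨fun hp => ?_, fun hp => ?_⟩
      · have := T.level_parent w hw
        rw [hp] at this
        rw [← h w (by omega), hp]
      · have := T'.level_parent w hw
        rw [hp] at this
        rw [h w (by omega), hp]
    rw [T.rank_eq_nodeRank, T'.rank_eq_nodeRank, ← hch]
    refine nodeRank_congr fun w hw => ih w hw ?_
    rw [level_of_mem_children hw]
    omega

theorem eq_of_parent_eq_of_rank_eq {v w : V} (hv : v ≠ s) (hw : w ≠ s)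
    (hp : T.parent v = T.parent w) (hr : T.rank v = T.rank w)
    (hrp : T.rank (T.parent w) = T.rank w) : v = w := by
  by_contra hne
  have := T.rank_multiple (T.parent w) (T.rank w)
    (fun y _ hy => hrp ▸ hy ▸ T.rank_le_rank_parent y)
    ⟨v, w, hne, ⟨hv, hp, hr⟩, hw, rfl, rfl⟩
  omega

end Children

section CountingRanks

variable [Fintype V] (T : RankedBFSTree G s)

theorem rank_le_maxRank (v : V) : T.rank v ≤ T.maxRank := Finset.le_sup (Finset.mem_univ v)

theorem sum_children_le_sum_level_succ {f : V → ℕ} (k : ℕ) :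
    ∑ v with level G s v = k, ∑ w ∈ T.children v, f w ≤ ∑ w with level G s w = k + 1, f w := by
  classical
  rw [← Finset.sum_biUnion]
  · refine Finset.sum_le_sum_of_subset fun w hw => ?_
    simp only [Finset.mem_biUnion, Finset.mem_filter, Finset.mem_univ, true_and] at hw ⊢
    obtain ⟨v, rfl, hw⟩ := hw
    exact level_of_mem_children hw
  · intro v _ v' _ hne
    refine Finset.disjoint_left.2 fun w hw hw' => hne ?_
    exact (mem_children.1 hw).2.symm.trans (mem_children.1 hw').2

theorem sum_two_pow_rank_level_le {k : ℕ} (hk : k ≤ Fintype.card V) :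
    ∑ v with level G s v = k, 2 ^ (T.rank v - 1) ≤ #{v | k ≤ level G s v} := by
  classical
  induction hk using Nat.decreasingInduction with
  | self =>
    rw [Finset.sum_eq_zero]
    · exact Nat.zero_le _
    · intro v hv
      exact absurd (Finset.mem_filter.1 hv).2 (level_lt_card v).ne
  | of_succ k _ ih =>
    have hsplit : #{v | k ≤ level G s v} =
        #{v | level G s v = k} + #{v | k + 1 ≤ level G s v} := by
      rw [← Finset.card_union_of_disjoint]
      · congr 1
        ext v
        simp only [Finset.mem_filter, Finset.mem_univ, true_and, Finset.mem_union]
        omega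
      · exact Finset.disjoint_filter.2 fun v _ h => by omega
    calc ∑ v with level G s v = k, 2 ^ (T.rank v - 1)
        ≤ ∑ v with level G s v = k, (1 + ∑ w ∈ T.children v, 2 ^ (T.rank w - 1)) :=
          Finset.sum_le_sum fun v _ => T.rank_eq_nodeRank v ▸ two_pow_nodeRank_le
      _ = #{v | level G s v = k} +
          ∑ v with level G s v = k, ∑ w ∈ T.children v, 2 ^ (T.rank w - 1) := by
          rw [Finset.sum_add_distrib, Finset.sum_const, smul_eq_mul, mul_one]
      _ ≤ #{v | level G s v = k} + #{v | k + 1 ≤ level G s v} :=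
          Nat.add_le_add_left ((T.sum_children_le_sum_level_succ k).trans ih) _
      _ = #{v | k ≤ level G s v} := hsplit.symm

theorem two_pow_maxRank_le_card : 2 ^ (T.maxRank - 1) ≤ Fintype.card V := by
  obtain ⟨v, -, hv⟩ := Finset.exists_mem_eq_sup Finset.univ ⟨s, Finset.mem_univ s⟩ T.rank
  calc 2 ^ (T.maxRank - 1) = 2 ^ (T.rank v - 1) := by rw [maxRank, hv]
    _ ≤ ∑ w with level G s w = level G s v, 2 ^ (T.rank w - 1) :=
        Finset.single_le_sum (f := fun w => 2 ^ (T.rank w - 1)) (fun _ _ => Nat.zero_le _)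
          (Finset.mem_filter.2 ⟨Finset.mem_univ v, rfl⟩)
    _ ≤ #{w | level G s v ≤ level G s w} := T.sum_two_pow_rank_level_le (level_lt_card v).le
    _ ≤ Fintype.card V := Finset.card_le_univ _

end CountingRanks

section Existence

variable [Finite V]

theorem exists_parent_eq (f : V → V) (hroot : f s = s) (hadj : ∀ v, v ≠ s → G.Adj (f v) v)
    (hlevel : ∀ v, v ≠ s → level G s v = level G s (f v) + 1) :
    ∃ T : RankedBFSTree G s, T.parent = f := by
  let child (v : V) : Finset V := (Set.toFinite {w | w ≠ s ∧ f w = v}).toFinset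
  have mem_child {v w : V} : w ∈ child v ↔ w ≠ s ∧ f w = v := by simp [child]
  have hwf : WellFounded fun w v => w ∈ child v := by
    refine wellFounded_of_level (G := G) (s := s) fun v w hw => ?_
    obtain ⟨hws, rfl⟩ := mem_child.1 hw
    exact hlevel w hws
  obtain ⟨ρ, hρ⟩ := exists_eq_nodeRank hwf
  refine ⟨⟨f, ρ, hroot, hadj, hlevel, fun v hv => ?_, fun v r hle h => ?_,
    fun v r hle h => ?_⟩, rfl⟩
  · have hempty : child v = ∅ :=
      Finset.eq_empty_of_forall_notMem fun w hw => hv w (mem_child.1 hw).1 (mem_child.1 hw).2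
    rw [hρ v, hempty, nodeRank_empty]
  · rw [hρ v, nodeRank_of_existsUnique (r := r)]
    · exact fun w hw => hle w (mem_child.1 hw).1 (mem_child.1 hw).2
    · simpa only [mem_child, and_assoc] using h
  · obtain ⟨w, w', hne, ⟨hw, hwv, hwr⟩, hw', hwv', hwr'⟩ := h
    rw [hρ v]
    exact nodeRank_of_ne (fun w hw => hle w (mem_child.1 hw).1 (mem_child.1 hw).2) hne
      (mem_child.2 ⟨hw, hwv⟩) hwr (mem_child.2 ⟨hw', hwv'⟩) hwr'

theorem nonempty_of_connected (hG : G.Connected) : Nonempty (RankedBFSTree G s) := by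
  classical
  choose! f hadj hlevel using fun v (hv : v ≠ s) => exists_adj_level hG hv
  obtain ⟨T, -⟩ := exists_parent_eq (Function.update f s s) (Function.update_self ..)
    (fun v hv => by simpa only [Function.update_of_ne hv] using hadj v hv)
    (fun v hv => by simpa only [Function.update_of_ne hv] using hlevel v hv)
  exact ⟨T⟩

/-- The parents of the nodes of level `l`, each listed with the ranks of its children. A GBST is
found by minimizing their number. -/
def parentRanks (T : RankedBFSTree G s) (l : ℕ) : Set (V × ℕ) :=
  (fun v => (T.parent v, T.rank v)) '' {v | v ≠ s ∧ level G s v = l}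

/-- Moving `w` to the parent of `v` merges two pairs of `parentRanks`: since `w` is the only child
of its parent with its rank, the pair `(T.parent w, T.rank w)` disappears. -/
theorem exists_parentRanks_ssubset (T : RankedBFSTree G s) {v w : V} (hv : v ≠ s) (hw : w ≠ s)
    (hlevel : level G s v = level G s w) (hr : T.rank v = T.rank w)
    (hp : T.parent v ≠ T.parent w) (hrw : T.rank (T.parent w) = T.rank w)
    (hadj : G.Adj (T.parent v) w) :
    ∃ T' : RankedBFSTree G s, T'.parentRanks (level G s w) ⊂ T.parentRanks (level G s w) ∧
      ∀ l > level G s w, T'.parentRanks l = T.parentRanks l := by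
  classical
  obtain ⟨T', hT'⟩ := exists_parent_eq (G := G) (s := s)
    (Function.update T.parent w (T.parent v))
    (by rw [Function.update_of_ne hw.symm, T.parent_root])
    (fun y hy => by
      rcases eq_or_ne y w with rfl | hyw
      · rwa [Function.update_self]
      · simpa only [Function.update_of_ne hyw] using T.adj_parent y hy)
    (fun y hy => by
      rcases eq_or_ne y w with rfl | hyw
      · rw [Function.update_self, ← hlevel, T.level_parent v hv]
      · simpa only [Function.update_of_ne hyw] using T.level_parent y hy)
  have hself : T'.parent w = T.parent v := by rw [hT', Function.update_self]
  have hother (y : V) (hy : y ≠ w) : T'.parent y = T.parent y := by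
    rw [hT', Function.update_of_ne hy]
  have hrank (y : V) (hy : level G s w ≤ level G s y) : T'.rank y = T.rank y :=
    rank_eq_of_parent_eq (fun y hy => hother y (by rintro rfl; exact lt_irrefl _ hy)) y hy
  refine ⟨T', Set.ssubset_iff_of_subset (fun x hx => ?_) |>.2
    ⟨(T.parent w, T.rank w), ⟨w, ⟨hw, rfl⟩, rfl⟩, fun hx => ?_⟩, fun l hl => ?_⟩
  · obtain ⟨y, ⟨hy, hyl⟩, rfl⟩ := hx
    simp only [hrank y hyl.ge]
    rcases eq_or_ne y w with rfl | hyw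
    · exact ⟨v, ⟨hv, hlevel⟩, by simp only [hself, hr]⟩
    · exact ⟨y, ⟨hy, hyl⟩, by simp only [hother y hyw]⟩
  · obtain ⟨y, ⟨hy, hyl⟩, hyx⟩ := hx
    obtain ⟨hyp, hyr⟩ := Prod.ext_iff.1 hyx
    rcases eq_or_ne y w with rfl | hyw
    · exact hp (hself.symm.trans hyp)
    · exact hyw (T.eq_of_parent_eq_of_rank_eq hy hw ((hother y hyw).symm.trans hyp)
        ((hrank y hyl.ge).symm.trans hyr) hrw)
  · refine Set.image_congr fun y hy => ?_
    rw [hrank y (hy.2 ▸ hl.le), hother y (by rintro rfl; exact hl.ne hy.2)]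

/-- A tree with the fewest pairs in `parentRanks`, comparing the deepest level first, is a GBST. -/
theorem exists_isGBST (hG : G.Connected) : ∃ T : RankedBFSTree G s, T.IsGBST := by
  have := Fintype.ofFinite V
  have := nonempty_of_connected (s := s) hG
  let size (T : RankedBFSTree G s) : Colex (Fin (Fintype.card V) → ℕ) :=
    toColex fun l => (T.parentRanks l).ncard
  refine ⟨Function.argmin size, fun v w hv hw hlevel hr hp _ hrw hadj => ?_⟩
  obtain ⟨T', hlt, heq⟩ :=
    exists_parentRanks_ssubset _ hv hw hlevel hr hp hrw hadj
  refine Function.not_lt_argmin size T' ⟨⟨level G s w, level_lt_card w⟩, fun l hl => ?_, ?_⟩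
  · exact congrArg Set.ncard (heq l hl)
  · exact Set.ncard_lt_ncard hlt ((Set.toFinite _).image _)

end Existence

section Ancestor

variable (T : RankedBFSTree G s)

/-- The node of level `i` on the tree path from `s` to `v`, if `i` is at most the level of `v`,
and `v` otherwise. -/
def ancestor (v : V) (i : ℕ) : V := T.parent^[level G s v - i] v

theorem ancestor_level (v : V) : T.ancestor v (level G s v) = v := by
  simp [ancestor]

variable {T} {v : V} {i j : ℕ}

theorem parent_ancestor_succ (hi : i < level G s v) :
    T.parent (T.ancestor v (i + 1)) = T.ancestor v i := by
  rw [ancestor, ancestor, ← Function.iterate_succ_apply' T.parent]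
  congr 2
  omega

theorem level_parent_eq_sub_one (T : RankedBFSTree G s) (v : V) :
    level G s (T.parent v) = level G s v - 1 := by
  rcases eq_or_ne v s with rfl | hv
  · simp [T.parent_root, level]
  · rw [T.level_parent v hv, Nat.add_sub_cancel]

theorem level_ancestor (hi : i ≤ level G s v) : level G s (T.ancestor v i) = i := by
  have hiterate (k : ℕ) : level G s (T.parent^[k] v) = level G s v - k := by
    induction k with
    | zero => rfl
    | succ k ih => rw [Function.iterate_succ_apply', level_parent_eq_sub_one, ih, Nat.sub_sub]
  rw [ancestor, hiterate]
  omega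

theorem ancestor_succ_ne_root (hi : i < level G s v) : T.ancestor v (i + 1) ≠ s := by
  intro h
  have := level_ancestor (T := T) (Nat.succ_le_of_lt hi)
  rw [Nat.succ_eq_add_one, h, level, SimpleGraph.dist_self] at this
  omega

theorem ancestor_zero (hG : G.Connected) : T.ancestor v 0 = s :=
  ((hG.dist_eq_zero_iff).1 (level_ancestor (T := T) (Nat.zero_le _))).symm

theorem antitone_rank_ancestor [Finite V] : Antitone fun i => T.rank (T.ancestor v i) := by
  refine antitone_nat_of_succ_le fun i => ?_
  rcases lt_or_ge i (level G s v) with hi | hi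
  · rw [← parent_ancestor_succ hi]
    exact T.rank_le_rank_parent _
  · simp [ancestor, Nat.sub_eq_zero_of_le hi, Nat.sub_eq_zero_of_le (hi.trans (Nat.le_succ i))]

end Ancestor

end RankedBFSTree

section Expectation

variable {α β : Type*} [Fintype α] [Fintype β]

/-- The expected value of `f` under a probability distribution `μ` on a finite type. -/
def expect (μ : PMF α) (f : α → ℝ) : ℝ := ∑ a, (μ a).toReal * f a

variable {μ : PMF α} {f g : α → ℝ}

theorem sum_toReal_eq_one (μ : PMF α) : ∑ a, (μ a).toReal = 1 := by
  rw [← ENNReal.toReal_sum fun a _ => μ.apply_ne_top a, ← tsum_fintype (L := .unconditional α),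
    μ.tsum_coe, ENNReal.toReal_one]

theorem expect_const (μ : PMF α) (c : ℝ) : expect μ (fun _ => c) = c := by
  rw [expect, ← Finset.sum_mul, sum_toReal_eq_one, one_mul]

theorem expect_affine (μ : PMF α) (f : α → ℝ) (c d : ℝ) :
    expect μ (fun a => c + d * f a) = c + d * expect μ f := by
  conv_rhs => rw [← expect_const μ c]
  simp only [expect, Finset.mul_sum, ← Finset.sum_add_distrib]
  exact Finset.sum_congr rfl fun a _ => by ring

theorem expect_sum {ι : Type*} (A : Finset ι) (F : ι → α → ℝ) :
    expect μ (fun a => ∑ i ∈ A, F i a) = ∑ i ∈ A, expect μ (F i) := by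
  simp only [expect, Finset.mul_sum]
  exact Finset.sum_comm

theorem expect_mono (h : ∀ a ∈ μ.support, f a ≤ g a) : expect μ f ≤ expect μ g := by
  refine Finset.sum_le_sum fun a _ => ?_
  by_cases ha : a ∈ μ.support
  · exact mul_le_mul_of_nonneg_left (h a ha) ENNReal.toReal_nonneg
  · rw [(μ.apply_eq_zero_iff a).2 ha, ENNReal.toReal_zero, zero_mul, zero_mul]

theorem expect_le_of_forall_le {c : ℝ} (h : ∀ a ∈ μ.support, f a ≤ c) : expect μ f ≤ c :=
  (expect_mono h).trans_eq (expect_const μ c)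

theorem expect_pure (a : α) (f : α → ℝ) : expect (PMF.pure a) f = f a := by
  classical
  rw [expect, Finset.sum_eq_single a]
  · simp
  · intro b _ hb
    simp [hb]
  · simp

theorem expect_bind (μ : PMF α) (κ : α → PMF β) (f : β → ℝ) :
    expect (μ.bind κ) f = expect μ fun a => expect (κ a) f := by
  have happly (b : β) : (μ.bind κ b).toReal = ∑ a, (μ a).toReal * (κ a b).toReal := by
    rw [PMF.bind_apply, tsum_fintype, ENNReal.toReal_sum fun a _ =>
      ENNReal.mul_ne_top (μ.apply_ne_top a) ((κ a).apply_ne_top b)]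
    simp only [ENNReal.toReal_mul]
  simp only [expect, happly, Finset.sum_mul, Finset.mul_sum, mul_assoc]
  exact Finset.sum_comm

end Expectation

section RandomSubset

variable {V : Type*} [Fintype V]

open scoped Classical in
theorem toReal_randomSubset_apply (q : V → unitInterval) (A : Finset V) :
    (randomSubset q A).toReal = (∏ v ∈ A, (q v : ℝ)) * ∏ v ∈ Aᶜ, (1 - (q v : ℝ)) := by
  simp only [randomSubset, PMF.ofFintype_apply, subsetWeight, ENNReal.toReal_mul,
    ENNReal.toReal_prod]
  congr 1
  · exact Finset.prod_congr rfl fun v _ => ENNReal.toReal_ofReal (q v).2.1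
  · exact Finset.prod_congr (by congr!) fun v _ => ENNReal.toReal_ofReal (sub_nonneg.2 (q v).2.2)

open scoped Classical in
theorem expect_randomSubset_subset_disjoint (q : V → unitInterval) {X Y : Finset V}
    (h : Disjoint X Y) :
    expect (randomSubset q) (fun A => if X ⊆ A ∧ Disjoint Y A then 1 else 0) =
      (∏ v ∈ X, (q v : ℝ)) * ∏ v ∈ Y, (1 - (q v : ℝ)) := by
  let inside (v : V) : ℝ := if v ∈ Y then 0 else q v
  let outside (v : V) : ℝ := if v ∈ X then 0 else 1 - q v
  have hadd (v : V) : inside v + outside v =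
      (if v ∈ X then (q v : ℝ) else 1) * (if v ∈ Y then 1 - (q v : ℝ) else 1) := by
    by_cases hx : v ∈ X
    · simp [inside, outside, hx, Finset.disjoint_left.1 h hx]
    · by_cases hy : v ∈ Y <;> simp [inside, outside, hx, hy]
  have hexpand : (∏ v ∈ X, (q v : ℝ)) * ∏ v ∈ Y, (1 - (q v : ℝ)) =
      ∑ A : Finset V, (∏ v ∈ A, inside v) * ∏ v ∈ Aᶜ, outside v := by
    rw [← Fintype.prod_add]
    simp only [hadd, Finset.prod_mul_distrib, Finset.prod_ite_mem, Finset.univ_inter]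
  rw [hexpand, expect]
  refine Finset.sum_congr rfl fun A _ => ?_
  rw [toReal_randomSubset_apply]
  split_ifs with hA
  · rw [mul_one]
    congr 1
    · exact Finset.prod_congr rfl fun v hv =>
        (if_neg fun hy => Finset.disjoint_left.1 hA.2 hy hv).symm
    · exact Finset.prod_congr rfl fun v hv =>
        (if_neg fun hx => Finset.mem_compl.1 hv (hA.1 hx)).symm
  · rw [mul_zero, eq_comm]
    rcases not_and_or.1 hA with hX | hY
    · obtain ⟨v, hv, hvA⟩ := Finset.not_subset.1 hX
      refine mul_eq_zero_of_right _ (Finset.prod_eq_zero (Finset.mem_compl.2 hvA) ?_)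
      exact if_pos hv
    · obtain ⟨v, hv, hvA⟩ := Finset.not_disjoint_iff.1 hY
      refine mul_eq_zero_of_left (Finset.prod_eq_zero hvA ?_) _
      exact if_pos hv

end RandomSubset

section OneRound

variable {V : Type*}

open scoped Classical in
/-- The indicator function of the event that `v` does not have the message. -/
def uninformed (v : V) (J : Finset V) : ℝ := if v ∈ J then 0 else 1

theorem uninformed_of_mem {v : V} {J : Finset V} (h : v ∈ J) : uninformed v J = 0 := if_pos h

theorem uninformed_of_notMem {v : V} {J : Finset V} (h : v ∉ J) : uninformed v J = 1 := if_neg h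

theorem uninformed_le_one (v : V) (J : Finset V) : uninformed v J ≤ 1 := by
  unfold uninformed
  split_ifs <;> simp

open scoped Classical in
/-- The probability with which `v` broadcasts if `J` is the set of informed nodes and informed nodes
follow `q`. -/
def sendProb (q : V → unitInterval) (J : Finset V) (v : V) : unitInterval :=
  if v ∈ J then q v else 0

variable [Fintype V]

open scoped Classical in
/-- The closed neighbourhood of `x`: these nodes decide whether `x` receives a packet. -/
def closedNbhd (G : SimpleGraph V) (x : V) : Finset V := {w | w = x ∨ G.Adj w x}

variable {G : SimpleGraph V} {M : FaultModel} {p : unitInterval} {q : V → unitInterval}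
  {J B F : Finset V} {u x : V}

theorem mem_closedNbhd {w : V} : w ∈ closedNbhd G x ↔ w = x ∨ G.Adj w x := by
  simp [closedNbhd]

theorem subset_nextInformed : J ⊆ nextInformed G M J B F := fun v hv => by
  simp [nextInformed, hv]

theorem subset_of_mem_support_roundStep {J' : Finset V}
    (h : J' ∈ (roundStep G M p q J).support) : J ⊆ J' := by
  simp only [roundStep, PMF.mem_support_bind_iff, PMF.mem_support_pure_iff] at h
  obtain ⟨B, -, F, -, rfl⟩ := h
  exact subset_nextInformed

open scoped Classical in
theorem exists_forall_receives (hadj : G.Adj u x) (hu : u ∈ B)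
    (hB : Disjoint ((closedNbhd G x).erase u) B) : ∃ a, ∀ F, a ∉ F → Receives G M B F x := by
  have hsilent (w : V) (hwu : w ≠ u) (hw : w = x ∨ G.Adj w x) : w ∉ B :=
    Finset.disjoint_left.1 hB (Finset.mem_erase.2 ⟨hwu, mem_closedNbhd.2 hw⟩)
  have hx : x ∉ B := hsilent x hadj.ne' (Or.inl rfl)
  have huniq (w : V) (hw : w ∈ B) (hwx : G.Adj w x) : w = u :=
    by_contra fun hwu => hsilent w hwu (Or.inr hwx) hw
  cases M with
  | sender => exact ⟨u, fun F hF => ⟨hx, u, hu, hadj, huniq, hF⟩⟩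
  | receiver => exact ⟨x, fun F hF => ⟨hx, u, hu, hadj, huniq, hF⟩⟩

open scoped Classical in
theorem expect_uninformed_nextInformed_le (hadj : G.Adj u x) (hu : u ∈ B)
    (hB : Disjoint ((closedNbhd G x).erase u) B) :
    expect (randomSubset fun _ : V => p) (fun F => uninformed x (nextInformed G M J B F)) ≤ p := by
  obtain ⟨a, ha⟩ := exists_forall_receives (M := M) hadj hu hB
  calc expect (randomSubset fun _ : V => p) (fun F => uninformed x (nextInformed G M J B F))
      ≤ expect (randomSubset fun _ : V => p)
          (fun F => if {a} ⊆ F ∧ Disjoint ∅ F then 1 else 0) := by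
        refine expect_mono fun F _ => ?_
        by_cases haF : a ∈ F
        · simpa [haF] using uninformed_le_one x _
        · rw [uninformed_of_mem (by simp [nextInformed, ha F haF])]
          split_ifs <;> simp
    _ = p := by
        rw [expect_randomSubset_subset_disjoint _ (Finset.disjoint_empty_right _)]
        simp

open scoped Classical in
theorem expect_roundStep_uninformed_le {A : Finset V} (hA : ∀ u ∈ A, G.Adj u x) :
    expect (roundStep G M p q J) (uninformed x) ≤
      1 - (1 - p) * ∑ u ∈ A, (sendProb q J u : ℝ) *
        ∏ w ∈ (closedNbhd G x).erase u, (1 - (sendProb q J w : ℝ)) := by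
  let onlySender (u : V) (B : Finset V) : Prop :=
    {u} ⊆ B ∧ Disjoint ((closedNbhd G x).erase u) B
  have hB (B : Finset V) :
      expect (randomSubset fun _ : V => p) (fun F => uninformed x (nextInformed G M J B F)) ≤
        1 + -(1 - p) * ∑ u ∈ A, if onlySender u B then 1 else 0 := by
    by_cases hex : ∃ u ∈ A, onlySender u B
    · obtain ⟨u, huA, huB, hdisj⟩ := hex
      have hsum : (∑ w ∈ A, if onlySender w B then 1 else 0 : ℝ) = 1 := by
        rw [Finset.sum_eq_single_of_mem u huA, if_pos ⟨huB, hdisj⟩]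
        refine fun w hw hwu => if_neg fun h => Finset.disjoint_left.1 hdisj ?_
          (Finset.singleton_subset_iff.1 h.1)
        exact Finset.mem_erase.2 ⟨hwu, mem_closedNbhd.2 (Or.inr (hA w hw))⟩
      have := expect_uninformed_nextInformed_le (M := M) (p := p) (J := J) (hA u huA)
        (Finset.singleton_subset_iff.1 huB) hdisj
      rw [hsum]
      linarith
    · rw [Finset.sum_eq_zero fun u hu => if_neg fun h => hex ⟨u, hu, h⟩, mul_zero, add_zero]
      exact expect_le_of_forall_le fun F _ => uninformed_le_one x _
  calc expect (roundStep G M p q J) (uninformed x)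
      = expect (randomSubset (sendProb q J)) fun B => expect (randomSubset fun _ : V => p)
          fun F => uninformed x (nextInformed G M J B F) := by
        change expect ((randomSubset (sendProb q J)).bind _) _ = _
        simp only [expect_bind, expect_pure]
    _ ≤ expect (randomSubset (sendProb q J)) fun B =>
          1 + -(1 - p) * ∑ u ∈ A, if onlySender u B then 1 else 0 := expect_mono fun B _ => hB B
    _ = _ := by
        rw [expect_affine, expect_sum, neg_mul, ← sub_eq_add_neg]
        congr 2
        refine Finset.sum_congr rfl fun u _ => ?_
        rw [expect_randomSubset_subset_disjoint _ (by simp), Finset.prod_singleton]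

end OneRound

section ManyRounds

variable {V : Type*} [Fintype V]

/-- The law of the set of informed nodes after the rounds `t + 1, …, t + k`, if `J` is the set of
informed nodes after round `t`. -/
def informedFrom (G : SimpleGraph V) (M : FaultModel) (p : unitInterval)
    (q : ℕ → V → unitInterval) (t : ℕ) : ℕ → Finset V → PMF (Finset V)
  | 0, J => PMF.pure J
  | k + 1, J => (informedFrom G M p q t k J).bind (roundStep G M p (q (t + k + 1)))

/-- The probability that `x` does not have the message after the rounds `t + 1, …, t + k`, if `J`
is the set of informed nodes after round `t`. -/
def missProb (G : SimpleGraph V) (M : FaultModel) (p : unitInterval) (q : ℕ → V → unitInterval)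
    (t k : ℕ) (J : Finset V) (x : V) : ℝ :=
  expect (informedFrom G M p q t k J) (uninformed x)

variable {G : SimpleGraph V} {M : FaultModel} {p : unitInterval} {q : ℕ → V → unitInterval}
  {t a b k : ℕ} {J : Finset V} {x : V}

theorem informedFrom_add :
    informedFrom G M p q t (a + b) J =
      (informedFrom G M p q t a J).bind (informedFrom G M p q (t + a) b) := by
  induction b with
  | zero => exact (PMF.bind_pure _).symm
  | succ b ih =>
    rw [← Nat.add_assoc, informedFrom, ih, PMF.bind_bind, ← Nat.add_assoc]
    rfl

theorem informedAfter_eq_informedFrom (s : V) (N : ℕ) :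
    informedAfter G M p q s N = informedFrom G M p q 0 N {s} := by
  induction N with
  | zero => rfl
  | succ N ih => rw [informedAfter, informedFrom, ih, Nat.zero_add]

theorem subset_of_mem_support_informedFrom {J' : Finset V}
    (h : J' ∈ (informedFrom G M p q t k J).support) : J ⊆ J' := by
  induction k generalizing J' with
  | zero => exact (PMF.mem_support_pure_iff _ _ |>.1 h).ge
  | succ k ih =>
    obtain ⟨J₁, h₁, h₂⟩ := (PMF.mem_support_bind_iff _ _ _).1 h
    exact (ih h₁).trans (subset_of_mem_support_roundStep h₂)

theorem missProb_one :
    missProb G M p q t 1 J x = expect (roundStep G M p (q (t + 1)) J) (uninformed x) := by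
  rw [missProb, informedFrom, informedFrom, PMF.pure_bind, Nat.add_zero]

theorem missProb_add :
    missProb G M p q t (a + b) J x =
      expect (informedFrom G M p q t a J) fun J' => missProb G M p q (t + a) b J' x := by
  rw [missProb, informedFrom_add, expect_bind]
  rfl

theorem missProb_le_one : missProb G M p q t k J x ≤ 1 :=
  expect_le_of_forall_le fun _ _ => uninformed_le_one x _

theorem missProb_le_zero_of_mem (h : x ∈ J) : missProb G M p q t k J x ≤ 0 :=
  expect_le_of_forall_le fun _ hJ' =>
    (uninformed_of_mem (subset_of_mem_support_informedFrom hJ' h)).le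

theorem missProb_le_uninformed : missProb G M p q t k J x ≤ uninformed x J := by
  by_cases h : x ∈ J
  · exact (missProb_le_zero_of_mem h).trans_eq (uninformed_of_mem h).symm
  · exact missProb_le_one.trans_eq (uninformed_of_notMem h).symm

theorem missProb_le_missProb_of_le (h : a ≤ b) :
    missProb G M p q t b J x ≤ missProb G M p q t a J x :=
  antitone_nat_of_succ_le (f := fun k => missProb G M p q t k J x) (fun k => by
    rw [missProb_add (a := k) (b := 1)]
    exact expect_mono fun _ _ => missProb_le_uninformed) h

theorem missProb_add_le {r : ℝ} (h : ∀ J', J ⊆ J' → missProb G M p q (t + a) b J' x ≤ r) :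
    missProb G M p q t (a + b) J x ≤ r :=
  missProb_add.trans_le <|
    expect_le_of_forall_le fun J' hJ' => h J' (subset_of_mem_support_informedFrom hJ')

/-- Condition on whether `w` has the message after the first `a` rounds. -/
theorem missProb_add_le_of_missProb_le (w : V) {y z r : ℝ} (hyz : y ≤ z)
    (hz : ∀ J', J ⊆ J' → missProb G M p q (t + a) b J' x ≤ z)
    (hy : ∀ J', J ⊆ J' → w ∈ J' → missProb G M p q (t + a) b J' x ≤ y)
    (hr : missProb G M p q t a J w ≤ r) :
    missProb G M p q t (a + b) J x ≤ y + (z - y) * r :=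
  calc missProb G M p q t (a + b) J x
      ≤ expect (informedFrom G M p q t a J) fun J' => y + (z - y) * uninformed w J' := by
        rw [missProb_add]
        refine expect_mono fun J' hJ' => ?_
        have hJJ' := subset_of_mem_support_informedFrom hJ'
        by_cases hw : w ∈ J'
        · simpa [uninformed_of_mem hw] using hy J' hJJ' hw
        · simpa [uninformed_of_notMem hw] using hz J' hJJ'
    _ = y + (z - y) * missProb G M p q t a J w := expect_affine _ _ _ _
    _ ≤ y + (z - y) * r := by gcongr

theorem missProb_one_le_of_unique_sender {u : V} (hadj : G.Adj u x) (hu : u ∈ J)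
    (hqu : q (t + 1) u = 1)
    (hsilent : ∀ w ∈ closedNbhd G x, w ≠ u → sendProb (q (t + 1)) J w = 0) :
    missProb G M p q t 1 J x ≤ p := by
  classical
  have hA : ∀ w ∈ ({u} : Finset V), G.Adj w x := fun w hw => Finset.mem_singleton.1 hw ▸ hadj
  have hprod : ∏ w ∈ (closedNbhd G x).erase u, (1 - (sendProb (q (t + 1)) J w : ℝ)) = 1 :=
    Finset.prod_eq_one fun w hw => by
      simp [hsilent w (Finset.mem_of_mem_erase hw) (Finset.ne_of_mem_erase hw)]
  refine (missProb_one.trans_le (expect_roundStep_uninformed_le hA)).trans_eq ?_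
  rw [Finset.sum_singleton, hprod, sendProb, if_pos hu, hqu, Set.Icc.coe_one]
  ring

theorem failureProb_le_sum_missProb (s : V) (N : ℕ) :
    failureProb G M p q s N ≤ ∑ v, ENNReal.ofReal (missProb G M p q 0 N {s} v) := by
  classical
  have hset : {J : Finset V | ∃ v, v ∉ J} = ⋃ v, {J | v ∉ J} := by
    ext J
    simp
  rw [failureProb, hset, informedAfter_eq_informedFrom]
  refine (MeasureTheory.measure_iUnion_fintype_le _ _).trans
    (Finset.sum_le_sum fun v _ => ?_)
  rw [PMF.toOuterMeasure_apply, tsum_fintype, missProb, expect,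
    ENNReal.ofReal_sum_of_nonneg fun J _ => mul_nonneg ENNReal.toReal_nonneg (by
      unfold uninformed
      split_ifs <;> simp)]
  refine Finset.sum_le_sum fun J _ => ?_
  by_cases h : v ∈ J
  · simp [h]
  · simp [uninformed_of_notMem h, h, ENNReal.ofReal_toReal (PMF.apply_ne_top _ _)]

end ManyRounds

section Decay

theorem quarter_le_one_sub_half_pow (i : ℕ) :
    (1 / 4 : ℝ) ≤ (1 - (1 / 2) ^ (i + 1)) ^ (2 ^ (i + 1)) := by
  induction i with
  | zero => norm_num
  | succ i ih =>
    have hle : ((1 : ℝ) / 2) ^ (i + 1) ≤ 1 := pow_le_one₀ (by norm_num) (by norm_num)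
    have hsq : (1 : ℝ) - (1 / 2) ^ (i + 1) ≤ (1 - (1 / 2) ^ (i + 2)) ^ 2 := by
      rw [pow_succ _ (i + 1)]
      nlinarith [sq_nonneg (((1 : ℝ) / 2) ^ (i + 1))]
    calc (1 / 4 : ℝ) ≤ (1 - (1 / 2) ^ (i + 1)) ^ (2 ^ (i + 1)) := ih
      _ ≤ ((1 - (1 / 2) ^ (i + 2)) ^ 2) ^ (2 ^ (i + 1)) :=
          pow_le_pow_left₀ (sub_nonneg.2 hle) hsq _
      _ = (1 - (1 / 2) ^ (i + 2)) ^ (2 ^ (i + 2)) := by rw [← pow_mul, pow_succ' 2 (i + 1)]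

theorem sixteenth_le_mul_half_pow {i m : ℕ} (hle : 2 ^ i ≤ m) (hlt : m < 2 ^ (i + 1)) :
    (1 / 16 : ℝ) ≤ m * ((1 / 2) ^ i * (1 - (1 / 2) ^ i) ^ (m - 1)) := by
  rcases i with _ | i
  · obtain rfl : m = 1 := by omega
    norm_num
  set r : ℝ := (1 / 2) ^ (i + 1) with hr
  have hr0 : 0 ≤ r := by positivity
  have hr1 : r ≤ 1 := pow_le_one₀ (by norm_num) (by norm_num)
  have hmean : 1 ≤ m * r := by
    have hm : (2 : ℝ) ^ (i + 1) ≤ m := by exact_mod_cast hle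
    calc (1 : ℝ) = 2 ^ (i + 1) * r := by rw [hr, ← mul_pow]; norm_num
      _ ≤ m * r := mul_le_mul_of_nonneg_right hm hr0
  have hsilent : 1 / 16 ≤ (1 - r) ^ (m - 1) :=
    calc (1 / 16 : ℝ) = (1 / 4) ^ 2 := by norm_num
      _ ≤ ((1 - r) ^ (2 ^ (i + 1))) ^ 2 :=
          pow_le_pow_left₀ (by norm_num) (quarter_le_one_sub_half_pow i) 2
      _ = (1 - r) ^ (2 ^ (i + 2)) := by rw [← pow_mul, ← pow_succ]
      _ ≤ (1 - r) ^ (m - 1) := pow_le_pow_of_le_one (by linarith) (by linarith)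
          ((Nat.sub_le m 1).trans hlt.le)
  calc (1 / 16 : ℝ) ≤ 1 * (1 - r) ^ (m - 1) := by rwa [one_mul]
    _ ≤ m * r * (1 - r) ^ (m - 1) := by gcongr
    _ = m * (r * (1 - r) ^ (m - 1)) := mul_assoc _ _ _

variable {V : Type*} {G : SimpleGraph V} {J J' : Finset V} {u x : V}

open scoped Classical in
/-- The neighbours of `x` in the set `J` of informed nodes. -/
def informedNeighbors (G : SimpleGraph V) (J : Finset V) (x : V) : Finset V := {u ∈ J | G.Adj u x}

theorem mem_informedNeighbors : u ∈ informedNeighbors G J x ↔ u ∈ J ∧ G.Adj u x := by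
  simp [informedNeighbors]

theorem informedNeighbors_mono (h : J ⊆ J') :
    informedNeighbors G J x ⊆ informedNeighbors G J' x := fun _ hu =>
  mem_informedNeighbors.2 ((mem_informedNeighbors.1 hu).imp_left (@h _))

variable [Fintype V] {M : FaultModel} {p : unitInterval} {q : ℕ → V → unitInterval}

open scoped Finset in
theorem missProb_one_le_of_const_sendProb {t : ℕ} {r : unitInterval} (hq : ∀ v, q (t + 1) v = r)
    (hx : x ∉ J) :
    missProb G M p q t 1 J x ≤ 1 - (1 - p) * (#(informedNeighbors G J x) *
      ((r : ℝ) * (1 - r) ^ (#(informedNeighbors G J x) - 1))) := by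
  classical
  set A := informedNeighbors G J x
  have hsend (w : V) (hw : w ∈ J) : sendProb (q (t + 1)) J w = r := (if_pos hw).trans (hq w)
  have hterm (u : V) (hu : u ∈ A) : (sendProb (q (t + 1)) J u : ℝ) *
      ∏ w ∈ (closedNbhd G x).erase u, (1 - (sendProb (q (t + 1)) J w : ℝ)) =
      r * (1 - r) ^ (#A - 1) := by
    rw [hsend u (mem_informedNeighbors.1 hu).1, ← Finset.card_erase_of_mem hu, ← Finset.prod_const]
    congr 1
    refine (Finset.prod_subset_one_on_sdiff ?_ (fun w hw => ?_) fun w hw => ?_).symm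
    · exact Finset.erase_subset_erase _ fun w hw =>
        mem_closedNbhd.2 (Or.inr (mem_informedNeighbors.1 hw).2)
    · have hwJ : w ∉ J := by
        intro hwJ
        obtain ⟨hw, hwA⟩ := Finset.mem_sdiff.1 hw
        rcases mem_closedNbhd.1 (Finset.mem_of_mem_erase hw) with rfl | hadj
        · exact hx hwJ
        · exact hwA (Finset.mem_erase.2
            ⟨Finset.ne_of_mem_erase hw, mem_informedNeighbors.2 ⟨hwJ, hadj⟩⟩)
      simp [sendProb, hwJ]
    · rw [hsend w (mem_informedNeighbors.1 (Finset.mem_of_mem_erase hw)).1]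
  have hA : ∀ u ∈ A, G.Adj u x := fun u hu => (mem_informedNeighbors.1 hu).2
  refine (missProb_one.trans_le (expect_roundStep_uninformed_le hA)).trans_eq ?_
  rw [Finset.sum_congr rfl hterm, Finset.sum_const, nsmul_eq_mul]

variable {L : ℕ}

/-- While `i` runs through a phase, the number of informed neighbours can only grow. Hence either
it is below `2 ^ (i + 1)` at some time `i`, or it exceeds the number of nodes at the end. -/
theorem missProb_decay_le (hq : ∀ j v, q (2 * j + 1) v = half ^ (j % L))
    (hL : Fintype.card V ≤ 2 ^ L) (m : ℕ) {k i : ℕ} (hik : i + k = L)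
    (h : 2 ^ i ≤ (informedNeighbors G J x).card) :
    missProb G M p q (2 * (L * m + i)) (2 * k) J x ≤ 1 - (1 - p) / 16 := by
  have hp : (p : ℝ) ≤ 1 := p.2.2
  have hp0 : (0 : ℝ) ≤ p := p.2.1
  induction k generalizing i J with
  | zero =>
    have hlt : (informedNeighbors G J x).card < Fintype.card V :=
      Finset.card_lt_univ_of_notMem (x := x) fun hx =>
        G.loopless.irrefl x (mem_informedNeighbors.1 hx).2
    obtain rfl : i = L := by omega
    omega
  | succ k ih =>
    by_cases hx : x ∈ J
    · exact (missProb_le_zero_of_mem hx).trans (by linarith)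
    by_cases hlt : (informedNeighbors G J x).card < 2 ^ (i + 1)
    · have hmod : (L * m + i) % L = i := by
        rw [Nat.mul_add_mod, Nat.mod_eq_of_lt (by omega)]
      have hone := missProb_one_le_of_const_sendProb (M := M) (p := p) (G := G)
        (fun v => (hq (L * m + i) v).trans (by rw [hmod])) hx
      have hhalf : ((half ^ i : unitInterval) : ℝ) = (1 / 2) ^ i := by simp [half]
      rw [hhalf] at hone
      have := mul_le_mul_of_nonneg_left (sixteenth_le_mul_half_pow h hlt) (sub_nonneg.2 hp)
      refine (missProb_le_missProb_of_le (show 1 ≤ 2 * (k + 1) by omega)).trans ?_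
      linarith
    · rw [show 2 * (k + 1) = 2 + 2 * k by ring]
      refine missProb_add_le fun J' hJ => ?_
      rw [show 2 * (L * m + i) + 2 = 2 * (L * m + (i + 1)) by ring]
      refine ih (by omega) ((not_lt.1 hlt).trans ?_)
      exact Finset.card_le_card (informedNeighbors_mono hJ)

theorem missProb_two_decay_phases_le (hq : ∀ j v, q (2 * j + 1) v = half ^ (j % L))
    (hL : Fintype.card V ≤ 2 ^ L) (hadj : G.Adj u x) (hu : u ∈ J) (t : ℕ) :
    missProb G M p q t (4 * L) J x ≤ 1 - (1 - p) / 16 := by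
  have hLpos : 0 < L := by
    have hcard : 1 < 2 ^ L := (Fintype.one_lt_card_iff.2 ⟨u, x, hadj.ne⟩).trans_le hL
    exact Nat.pos_of_ne_zero fun h => by simp [h] at hcard
  obtain ⟨m, a, hma, ha⟩ : ∃ m a, t + a = 2 * (L * m) ∧ a ≤ 2 * L := by
    have hdiv := Nat.div_add_mod t (2 * L)
    have hlt := Nat.mod_lt t (show 0 < 2 * L by omega)
    refine ⟨t / (2 * L) + 1, 2 * L - t % (2 * L), ?_, Nat.sub_le _ _⟩
    rw [show 2 * (L * (t / (2 * L) + 1)) = 2 * L * (t / (2 * L)) + 2 * L by ring]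
    omega
  refine (missProb_le_missProb_of_le (show a + 2 * L ≤ 4 * L by omega)).trans ?_
  refine missProb_add_le fun J' hJ => ?_
  rw [hma, ← Nat.add_zero (L * m)]
  refine missProb_decay_le hq hL m (i := 0) (k := L) (Nat.zero_add L) ?_
  rw [pow_zero]
  exact Finset.card_pos.2 ⟨u, mem_informedNeighbors.2 ⟨hJ hu, hadj⟩⟩

end Decay

section Fast

/-- If `R` is the largest rank, then the fast nodes of rank `r` in block `b` of the levels broadcast
in the even rounds of superround `σ`. -/
def IsActive (R r b σ : ℕ) : Prop := (b : ℤ) - 6 * r ≡ σ [ZMOD 6 * R]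

variable {R r r' b σ : ℕ}

theorem IsActive.rank_eq (h : IsActive R r b σ) (h' : IsActive R r' b σ) (hr : 1 ≤ r)
    (hrR : r ≤ R) (hr' : 1 ≤ r') (hr'R : r' ≤ R) : r = r' := by
  have hdvd : 6 * (R : ℤ) ∣ 6 * ((r : ℤ) - r') := by
    convert (h.trans h'.symm).dvd using 1
    ring
  have hzero : 6 * ((r : ℤ) - r') = 0 := Int.eq_zero_of_abs_lt_dvd hdvd (by rw [abs_lt]; omega)
  omega

theorem IsActive.succ (h : IsActive R r b σ) : IsActive R r (b + 1) (σ + 1) := by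
  unfold IsActive
  push_cast
  convert Int.ModEq.add_right 1 h using 1
  ring

theorem exists_isActive_add (hR : 1 ≤ R) (r b m : ℕ) : ∃ z < 6 * R, IsActive R r b (m + z) := by
  obtain ⟨z, hz, hmod⟩ := Int.existsUnique_equiv_nat ((b : ℤ) - 6 * r - m)
    (show (0 : ℤ) < 6 * R by omega)
  refine ⟨z, by omega, ?_⟩
  unfold IsActive
  push_cast
  convert (Int.ModEq.add_left (m : ℤ) hmod).symm using 1
  ring

theorem exists_isActive_start {w : ℕ} (hR : 1 ≤ R) (hw : 1 ≤ w) (r b t : ℕ) :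
    ∃ σ a, t + a = 2 * (w * σ) ∧ 0 < a ∧ a ≤ 12 * R * w ∧ IsActive R r b σ := by
  obtain ⟨z, hz, hact⟩ := exists_isActive_add hR r b (t / (2 * w) + 1)
  have hlt : t < 2 * w * (t / (2 * w) + 1) := Nat.lt_mul_div_succ t (by omega)
  have hle : 2 * w * (t / (2 * w)) ≤ t := Nat.mul_div_le t (2 * w)
  have hperiod : w * (z + 1) ≤ w * (6 * R) := Nat.mul_le_mul_left w hz
  have hstart : t < 2 * (w * (t / (2 * w) + 1 + z)) := by nlinarith
  refine ⟨_, 2 * (w * (t / (2 * w) + 1 + z)) - t, Nat.add_sub_of_le hstart.le,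
    Nat.sub_pos_of_lt hstart, ?_, hact⟩
  rw [Nat.sub_le_iff_le_add]
  nlinarith

theorem exists_maximal_constant_stretch {α : Type*} (f : ℕ → α) {i d B : ℕ} (hid : i < d)
    (hiB : i < B) (hf : f (i + 1) = f i) :
    ∃ j, i < j ∧ j ≤ d ∧ j ≤ B ∧ f j = f i ∧ (j < d → f (j + 1) = f j → j = B) := by
  classical
  set j := Nat.findGreatest (fun j => f j = f i) (min d B) with hj
  have hjmin : j ≤ min d B := Nat.findGreatest_le _
  have hij : i + 1 ≤ j := Nat.le_findGreatest (by omega) hf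
  have hfj : f j = f i := Nat.findGreatest_spec (P := fun j => f j = f i) (m := i + 1) (by omega) hf
  refine ⟨j, by omega, by omega, by omega, hfj, fun hjd hsucc => ?_⟩
  by_contra hjB
  exact Nat.findGreatest_is_greatest (hj ▸ Nat.lt_succ_self j) (by omega) (hsucc.trans hfj)

variable {V : Type*} {G : SimpleGraph V} {s : V} {T : RankedBFSTree G s}

theorem RankedBFSTree.IsGBST.eq_parent_of_adj_of_isFast (hT : T.IsGBST) {w x : V} (hx : x ≠ s)
    (hrank : T.rank (T.parent x) = T.rank x) (hadj : G.Adj w x) (hw : T.IsFast w)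
    (hlevel : level G s w = level G s (T.parent x)) (hr : T.rank w = T.rank x) :
    w = T.parent x := by
  obtain ⟨y, hy, rfl, hry⟩ := hw
  by_contra hne
  refine hT y x hy hx ?_ (hry.trans hr) hne hry.symm hrank hadj
  rw [T.level_parent y hy, T.level_parent x hx, hlevel]

theorem adj_and_level_eq_of_modEq_parent (hG : G.Connected) {w x : V} (hx : x ≠ s)
    (hw : w = x ∨ G.Adj w x) (hmod : level G s w ≡ level G s (T.parent x) [MOD 3]) :
    G.Adj w x ∧ level G s w = level G s (T.parent x) := by
  have hlevel := T.level_parent x hx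
  unfold Nat.ModEq at hmod
  rcases hw with rfl | hadj
  · omega
  · have hwx : level G s w ≤ level G s x + 1 :=
      hG.dist_triangle.trans_eq (by rw [SimpleGraph.dist_eq_one_iff_adj.2 hadj.symm]; rfl)
    have hxw : level G s x ≤ level G s w + 1 :=
      hG.dist_triangle.trans_eq (by rw [SimpleGraph.dist_eq_one_iff_adj.2 hadj]; rfl)
    exact ⟨hadj, by omega⟩

variable [Fintype V] {S c L : ℕ}

theorem robustFASTBC_odd (j : ℕ) (v : V) :
    robustFASTBC T S c L (2 * j + 1) v = half ^ (j % L) := by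
  rw [robustFASTBC, if_pos (odd_two_mul_add_one j), Nat.add_sub_cancel,
    Nat.mul_div_cancel_left j two_pos]

open scoped Classical in
theorem robustFASTBC_even (j : ℕ) (v : V) :
    robustFASTBC T S c L (2 * j) v =
      if T.IsFast v ∧ IsActive T.maxRank (T.rank v) (level G s v / S) (j / (c * S)) ∧
        level G s v ≡ 2 * j [MOD 3] then 1 else 0 := by
  rw [robustFASTBC, if_neg (Nat.not_odd_iff_even.2 (even_two_mul j)),
    Nat.mul_div_cancel_left j two_pos]
  congr

variable {M : FaultModel} {p : unitInterval} {J : Finset V} {m : ℕ} {x : V}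

theorem missProb_even_round_le (hG : G.Connected) (hT : T.IsGBST) (hx : x ≠ s)
    (hrank : T.rank (T.parent x) = T.rank x)
    (hact : IsActive T.maxRank (T.rank x) (level G s (T.parent x) / S) ((m + 1) / (c * S)))
    (hmod : level G s (T.parent x) ≡ 2 * (m + 1) [MOD 3]) (hJ : T.parent x ∈ J) :
    missProb G M p (robustFASTBC T S c L) (2 * m + 1) 1 J x ≤ p := by
  classical
  refine missProb_one_le_of_unique_sender (T.adj_parent x hx) hJ ?_ fun w hw hne => ?_
  · rw [show 2 * m + 1 + 1 = 2 * (m + 1) by ring, robustFASTBC_even, if_pos]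
    exact ⟨⟨x, hx, rfl, hrank.symm⟩, hrank ▸ hact, hmod⟩
  · unfold sendProb
    split_ifs with hwJ
    swap; · rfl
    rw [show 2 * m + 1 + 1 = 2 * (m + 1) by ring, robustFASTBC_even, if_neg]
    rintro ⟨hfast, hactw, hmodw⟩
    obtain ⟨hadj, hlevel⟩ := adj_and_level_eq_of_modEq_parent hG hx (mem_closedNbhd.1 hw)
      (hmodw.trans hmod.symm)
    rw [hlevel] at hactw
    have hr : T.rank w = T.rank x := hactw.rank_eq hact (T.one_le_rank w) (T.rank_le_maxRank w)
      (T.one_le_rank x) (T.rank_le_maxRank x)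
    exact hne (hT.eq_parent_of_adj_of_isFast hx hrank hadj hfast hlevel hr)

/-- The condition modulo `3` holds in one of three consecutive even rounds. -/
theorem missProb_six_rounds_le (hG : G.Connected) (hT : T.IsGBST) (hx : x ≠ s)
    (hrank : T.rank (T.parent x) = T.rank x)
    (hact : IsActive T.maxRank (T.rank x) (level G s (T.parent x) / S) σ)
    (hstart : c * S * σ ≤ m) (hend : m + 3 < c * S * (σ + 1)) (hJ : T.parent x ∈ J) :
    missProb G M p (robustFASTBC T S c L) (2 * m) 6 J x ≤ p := by
  obtain ⟨a, ha, hmod⟩ : ∃ a < 3, level G s (T.parent x) ≡ 2 * (m + a + 1) [MOD 3] := by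
    refine ⟨(2 * level G s (T.parent x) + 2 * m + 2) % 3, Nat.mod_lt _ three_pos, ?_⟩
    unfold Nat.ModEq
    omega
  have hσ : (m + a + 1) / (c * S) = σ :=
    Nat.div_eq_of_lt_le (by rw [mul_comm]; omega) (by rw [mul_comm]; omega)
  refine (missProb_le_missProb_of_le (show 2 * a + 1 + 1 ≤ 6 by omega)).trans ?_
  refine missProb_add_le fun J' hJJ' => ?_
  rw [show 2 * m + (2 * a + 1) = 2 * (m + a) + 1 by ring]
  exact missProb_even_round_le hG hT hx hrank (hσ.symm ▸ hact) hmod (hJJ' hJ)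

/-- Six rounds extend the informed part of the stretch by one node except with probability `p`.
Hence the expectation of `2 ^ (number of missing nodes)` shrinks by the factor
`p + (1 - p) / 2 = (1 + p) / 2`. -/
theorem missProb_stretch_le (hG : G.Connected) (hT : T.IsGBST) {v : V} {i j : ℕ}
    (hact : IsActive T.maxRank r b σ) (hij : i ≤ j) (hj : j ≤ level G s v) (hib : b * S ≤ i)
    (hjb : j ≤ (b + 1) * S) (hri : T.rank (T.ancestor v i) ≤ r)
    (hrj : r ≤ T.rank (T.ancestor v j)) (g : ℕ) (hstart : c * S * σ ≤ m)
    (hend : m + 3 * g < c * S * (σ + 1)) (hJ : T.ancestor v i ∈ J) :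
    missProb G M p (robustFASTBC T S c L) (2 * m) (6 * g) J (T.ancestor v j) ≤
      2 ^ (j - i) * ((1 + p) / 2) ^ g := by
  have hp0 : (0 : ℝ) ≤ p := p.2.1
  induction g generalizing m i J with
  | zero =>
    rw [pow_zero, mul_one]
    exact missProb_le_one.trans (one_le_pow₀ one_le_two)
  | succ g ih =>
    rcases hij.eq_or_lt with rfl | hlt
    · exact (missProb_le_zero_of_mem hJ).trans (by positivity)
    have hanti := T.antitone_rank_ancestor (v := v)
    have hri' : T.rank (T.ancestor v (i + 1)) ≤ r := (hanti (Nat.le_succ i)).trans hri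
    have hrank : T.rank (T.ancestor v i) = r := hri.antisymm (hrj.trans (hanti hij))
    have hrank' : T.rank (T.ancestor v (i + 1)) = r := hri'.antisymm (hrj.trans (hanti hlt))
    have hparent := T.parent_ancestor_succ (hlt.trans_le hj)
    have hblock : i / S = b := Nat.div_eq_of_lt_le hib (hlt.trans_le hjb)
    have hstep : missProb G M p (robustFASTBC T S c L) (2 * m) 6 J (T.ancestor v (i + 1)) ≤ p := by
      refine missProb_six_rounds_le (σ := σ) hG hT (T.ancestor_succ_ne_root (hlt.trans_le hj))
        ?_ ?_ hstart (by omega) ?_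
      · rw [hparent, hrank, hrank']
      · rwa [hparent, T.level_ancestor (hij.trans hj), hblock, hrank']
      · rwa [hparent]
    have hpow : (2 : ℝ) ^ (j - i) = 2 * 2 ^ (j - (i + 1)) := by rw [← pow_succ']; congr 1; omega
    rw [show 6 * (g + 1) = 6 + 6 * g by ring]
    refine (missProb_add_le_of_missProb_le (T.ancestor v (i + 1))
      (y := 2 ^ (j - (i + 1)) * ((1 + p) / 2) ^ g) (z := 2 ^ (j - i) * ((1 + p) / 2) ^ g)
      ?_ (fun J' hJJ' => ?_) (fun J' _ hmem => ?_) hstep).trans_eq ?_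
    · gcongr
      · exact one_le_two
      · exact Nat.le_succ i
    · exact ih (m := m + 3) hij hib hri (by omega) (by omega) (hJJ' hJ)
    · exact ih (m := m + 3) hlt (by omega) hri' (by omega) (by omega) hmem
    · rw [hpow, pow_succ]
      ring

end Fast

section Potential

theorem exp_neg_three_mul_add_half_le {x : ℝ} (h0 : 0 ≤ x) (h1 : x ≤ 1 / 16) :
    Real.exp (-(3 * x)) + x / 2 ≤ Real.exp (-x) := by
  have hsplit : Real.exp (-(3 * x)) = Real.exp (-x) * Real.exp (-(2 * x)) := by
    rw [← Real.exp_add]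
    ring_nf
  have hlower : 15 / 16 ≤ Real.exp (-x) := by linarith [Real.add_one_le_exp (-x)]
  have hupper : Real.exp (-(2 * x)) ≤ 1 - x := by
    rw [Real.exp_neg, inv_le_comm₀ (Real.exp_pos _) (by linarith)]
    refine le_trans ?_ (Real.add_one_le_exp (2 * x))
    rw [inv_le_iff_one_le_mul₀ (by linarith)]
    nlinarith
  rw [hsplit]
  nlinarith [mul_le_mul_of_nonneg_left hupper (Real.exp_pos (-x)).le,
    mul_le_mul_of_nonneg_right hlower h0]

theorem exp_neg_mul_add (lam : ℝ) (k k' : ℕ) :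
    Real.exp (-(lam * (k + k' : ℕ))) = Real.exp (-(lam * k)) * Real.exp (-(lam * k')) := by
  rw [← Real.exp_add]
  push_cast
  ring_nf

theorem two_mul_le_period {R : ℕ} (hR : 1 ≤ R) (w L : ℕ) : 2 * w ≤ 12 * R * w + 4 * L :=
  (Nat.mul_le_mul_right _ (by omega)).trans (Nat.le_add_right _ _)

/-- With largest rank `R`, the probability of missing the message may be expected to decay by the
factor `exp (-lam)` per round. The first condition says that little is lost in one full period of
the schedule and two Decay phases, the second one that the advance by one block in an active
superround outweighs the risk that it fails. -/
structure IsRate (p : unitInterval) (R S c L : ℕ) (lam : ℝ) : Prop where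
  period_le : lam * (12 * R * (c * S) + 4 * L : ℕ) ≤ (1 - p) / 64
  superround_le : 2 ^ S * ((1 + (p : ℝ)) / 2) ^ ((c * S - 1) / 3) ≤ lam * (c * S : ℕ) / 2

namespace IsRate

variable {p : unitInterval} {R S c L : ℕ} {lam : ℝ}

theorem rate_mul_superround_pos (h : IsRate p R S c L lam) : 0 < lam * (c * S : ℕ) := by
  have hp : (0 : ℝ) ≤ p := p.2.1
  have hpos : 0 < (2 : ℝ) ^ S * ((1 + (p : ℝ)) / 2) ^ ((c * S - 1) / 3) := by positivity
  linarith [h.superround_le]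

theorem superround_pos (h : IsRate p R S c L lam) : 0 < c * S :=
  Nat.pos_of_ne_zero fun h0 => by simpa [h0] using h.rate_mul_superround_pos

theorem pos (h : IsRate p R S c L lam) : 0 < lam :=
  pos_of_mul_pos_left h.rate_mul_superround_pos (Nat.cast_nonneg _)

theorem one_sub_le_exp (h : IsRate p R S c L lam) {k : ℕ} (hk : k ≤ 12 * R * (c * S) + 4 * L) :
    1 - (1 - p) / 64 ≤ Real.exp (-(lam * k)) := by
  have hle : lam * k ≤ lam * (12 * R * (c * S) + 4 * L : ℕ) :=
    mul_le_mul_of_nonneg_left (Nat.cast_le.2 hk) h.pos.le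
  linarith [h.period_le, Real.add_one_le_exp (-(lam * k))]

theorem rate_mul_superround_le (h : IsRate p R S c L lam) (hR : 1 ≤ R) :
    lam * (2 * (c * S) : ℕ) ≤ 1 / 16 := by
  have hp : (0 : ℝ) ≤ p := p.2.1
  have hle : lam * (2 * (c * S) : ℕ) ≤ lam * (12 * R * (c * S) + 4 * L : ℕ) :=
    mul_le_mul_of_nonneg_left (Nat.cast_le.2 (two_mul_le_period hR _ _)) h.pos.le
  linarith [h.period_le]

end IsRate

variable {V : Type*} {G : SimpleGraph V} {s : V} {T : RankedBFSTree G s} {S c L i j : ℕ}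
  {lam : ℝ} {v : V}

/-- The potential of the ancestor of `v` in level `i`: a factor `16` for each rank and a factor
`exp (6 * lam * (c * S))` for each block of levels which the message has yet to cross. -/
def pathPotential (T : RankedBFSTree G s) (c S : ℕ) (lam : ℝ) (v : V) (i : ℕ) : ℝ :=
  2 * 16 ^ T.rank (T.ancestor v i) *
    Real.exp (3 * (lam * (2 * (c * S) : ℕ))) ^ (level G s v / S - i / S)

theorem two_le_pathPotential (hlam : 0 ≤ lam) : 2 ≤ pathPotential T c S lam v i := by
  have hrank : (1 : ℝ) ≤ 16 ^ T.rank (T.ancestor v i) := one_le_pow₀ (by norm_num)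
  have hblock : 1 ≤ Real.exp (3 * (lam * (2 * (c * S) : ℕ))) ^ (level G s v / S - i / S) :=
    one_le_pow₀ (Real.one_le_exp (by positivity))
  unfold pathPotential
  nlinarith

theorem sixteen_pow_mul_pathPotential_le (hlam : 0 ≤ lam) (hij : i ≤ j) {a : ℕ}
    (hrank : T.rank (T.ancestor v j) + a ≤ T.rank (T.ancestor v i)) :
    16 ^ a * pathPotential T c S lam v j ≤ pathPotential T c S lam v i := by
  have hexp : 1 ≤ Real.exp (3 * (lam * (2 * (c * S) : ℕ))) := Real.one_le_exp (by positivity)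
  have hblock : i / S ≤ j / S := Nat.div_le_div_right hij
  calc 16 ^ a * pathPotential T c S lam v j
      = 2 * 16 ^ (T.rank (T.ancestor v j) + a) *
          Real.exp (3 * (lam * (2 * (c * S) : ℕ))) ^ (level G s v / S - j / S) := by
        rw [pathPotential, pow_add]
        ring
    _ ≤ pathPotential T c S lam v i := by
        unfold pathPotential
        gcongr
        norm_num

theorem pathPotential_eq_of_next_block (hj : j ≤ level G s v) (hblock : j / S = i / S + 1)
    (hrank : T.rank (T.ancestor v j) = T.rank (T.ancestor v i)) :
    pathPotential T c S lam v j =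
      pathPotential T c S lam v i * Real.exp (-(3 * (lam * (2 * (c * S) : ℕ)))) := by
  have hle : j / S ≤ level G s v / S := Nat.div_le_div_right hj
  have hcancel : Real.exp (3 * (lam * (2 * (c * S) : ℕ))) *
      Real.exp (-(3 * (lam * (2 * (c * S) : ℕ)))) = 1 := by
    rw [← Real.exp_add, add_neg_cancel, Real.exp_zero]
  unfold pathPotential
  rw [hrank, show level G s v / S - i / S = level G s v / S - j / S + 1 by omega, pow_succ,
    mul_assoc (_ * _), mul_assoc (_ ^ _), hcancel, mul_one]

variable [Fintype V] {M : FaultModel} {p : unitInterval} {J : Finset V} {k t σ : ℕ}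

/-- The bounds on the probability that `v` misses the message for another `k` rounds if its ancestor
in level `i` has it: at any time, if the next tree edge is slow, and if the next tree edge is fast
and a superround in which it is active begins. -/
structure PathBounds (T : RankedBFSTree G s) (M : FaultModel) (p : unitInterval) (S c L : ℕ)
    (lam : ℝ) (v : V) (k : ℕ) : Prop where
  all : ∀ i ≤ level G s v, ∀ t J, T.ancestor v i ∈ J →
    missProb G M p (robustFASTBC T S c L) t k J v ≤
      4 * pathPotential T c S lam v i * Real.exp (-(lam * k))
  slow : ∀ i < level G s v, T.rank (T.ancestor v (i + 1)) < T.rank (T.ancestor v i) →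
    ∀ t J, T.ancestor v i ∈ J →
    missProb G M p (robustFASTBC T S c L) t k J v ≤
      pathPotential T c S lam v i * Real.exp (-(lam * k))
  aligned : ∀ i < level G s v, T.rank (T.ancestor v (i + 1)) = T.rank (T.ancestor v i) →
    ∀ σ, IsActive T.maxRank (T.rank (T.ancestor v i)) (i / S) σ → ∀ J, T.ancestor v i ∈ J →
    missProb G M p (robustFASTBC T S c L) (2 * (c * S * σ)) k J v ≤
      2 * pathPotential T c S lam v i * Real.exp (-(lam * k))

theorem missProb_le_pathPotential_of_le_period (h : IsRate p T.maxRank S c L lam)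
    (hk : k ≤ 12 * T.maxRank * (c * S) + 4 * L) (i : ℕ) :
    missProb G M p (robustFASTBC T S c L) t k J v ≤
      pathPotential T c S lam v i * Real.exp (-(lam * k)) := by
  have hp : (0 : ℝ) ≤ p := p.2.1
  have hP := two_le_pathPotential (T := T) (c := c) (S := S) (v := v) (i := i) h.pos.le
  refine missProb_le_one.trans ?_
  nlinarith [h.one_sub_le_exp hk]

theorem PathBounds.of_le_period (h : IsRate p T.maxRank S c L lam)
    (hk : k ≤ 12 * T.maxRank * (c * S) + 4 * L) : PathBounds T M p S c L lam v k := by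
  have hpos (i : ℕ) : 0 ≤ pathPotential T c S lam v i * Real.exp (-(lam * k)) :=
    mul_nonneg (zero_le_two.trans (two_le_pathPotential h.pos.le)) (Real.exp_pos _).le
  refine ⟨fun i _ t J _ => ?_, fun i _ _ t J _ => ?_, fun i _ _ σ _ J _ => ?_⟩
  · linarith [hpos i, missProb_le_pathPotential_of_le_period (M := M) (t := t) (J := J) (v := v)
      h hk i]
  · exact missProb_le_pathPotential_of_le_period h hk i
  · linarith [hpos i, missProb_le_pathPotential_of_le_period (M := M) (t := 2 * (c * S * σ))
      (J := J) (v := v) h hk i]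

theorem PathBounds.slow_step (h : IsRate p T.maxRank S c L lam) (hL : Fintype.card V ≤ 2 ^ L)
    (hk : PathBounds T M p S c L lam v k) (hi : i < level G s v)
    (hslow : T.rank (T.ancestor v (i + 1)) < T.rank (T.ancestor v i)) (hJ : T.ancestor v i ∈ J) :
    missProb G M p (robustFASTBC T S c L) t (12 * T.maxRank * (c * S) + 4 * L + k) J v ≤
      pathPotential T c S lam v i *
        Real.exp (-(lam * (12 * T.maxRank * (c * S) + 4 * L + k : ℕ))) := by
  have hp : (p : ℝ) ≤ 1 := p.2.2
  set W := 12 * T.maxRank * (c * S) + 4 * L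
  set P := pathPotential T c S lam v i
  set E := Real.exp (-(lam * k))
  have hPE : 0 < P * E :=
    mul_pos (zero_lt_two.trans_le (two_le_pathPotential h.pos.le)) (Real.exp_pos _)
  have hadj : G.Adj (T.ancestor v i) (T.ancestor v (i + 1)) := by
    have := T.adj_parent _ (T.ancestor_succ_ne_root hi)
    rwa [T.parent_ancestor_succ hi] at this
  have hnext : missProb G M p (robustFASTBC T S c L) t W J (T.ancestor v (i + 1)) ≤
      1 - (1 - p) / 16 :=
    (missProb_le_missProb_of_le (Nat.le_add_left _ _)).trans
      (missProb_two_decay_phases_le robustFASTBC_odd hL hadj hJ t)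
  have hpot : 16 * pathPotential T c S lam v (i + 1) ≤ P := by
    simpa using sixteen_pow_mul_pathPotential_le (a := 1) h.pos.le (Nat.le_succ i) hslow
  have hstep := missProb_add_le_of_missProb_le (x := v) (b := k) (T.ancestor v (i + 1))
    (y := P / 4 * E) (z := P * E) (by linarith)
    (fun J' hJJ' => hk.slow i hi hslow _ J' (hJJ' hJ))
    (fun J' _ hmem => (hk.all (i + 1) hi _ J' hmem).trans
      (mul_le_mul_of_nonneg_right (by linarith) (Real.exp_pos _).le)) hnext
  refine hstep.trans ?_
  rw [exp_neg_mul_add]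
  nlinarith [mul_le_mul_of_nonneg_left (h.one_sub_le_exp le_rfl) hPE.le]

theorem missProb_superround_le (hG : G.Connected) (hT : T.IsGBST)
    (h : IsRate p T.maxRank S c L lam) (hij : i ≤ j) (hj : j ≤ level G s v)
    (hjS : j ≤ (i / S + 1) * S) (hrank : T.rank (T.ancestor v j) = T.rank (T.ancestor v i))
    (hact : IsActive T.maxRank (T.rank (T.ancestor v i)) (i / S) σ) (hJ : T.ancestor v i ∈ J) :
    missProb G M p (robustFASTBC T S c L) (2 * (c * S * σ)) (2 * (c * S)) J (T.ancestor v j) ≤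
      lam * (c * S : ℕ) / 2 := by
  have hp : (0 : ℝ) ≤ p := p.2.1
  have hcS := h.superround_pos
  have hg : 3 * ((c * S - 1) / 3) ≤ c * S - 1 := Nat.mul_div_le _ _
  have hiS : i / S * S ≤ i := Nat.div_mul_le_self i S
  have hjiS : j - i ≤ S := by
    rw [Nat.succ_mul] at hjS
    omega
  refine (missProb_le_missProb_of_le (show 6 * ((c * S - 1) / 3) ≤ 2 * (c * S) by omega)).trans ?_
  refine (missProb_stretch_le hG hT hact hij hj hiS hjS le_rfl hrank.ge _ le_rfl ?_ hJ).trans ?_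
  · rw [Nat.mul_succ]
    omega
  · refine le_trans ?_ h.superround_le
    gcongr
    exact one_le_two

theorem PathBounds.missProb_le_of_stretch_end_mem (h : IsRate p T.maxRank S c L lam)
    (hk : PathBounds T M p S c L lam v k) (hij : i ≤ j) (hj : j ≤ level G s v)
    (hrank : T.rank (T.ancestor v j) = T.rank (T.ancestor v i))
    (hend : j < level G s v → T.rank (T.ancestor v (j + 1)) = T.rank (T.ancestor v j) →
      j = (i / S + 1) * S)
    (hact : IsActive T.maxRank (T.rank (T.ancestor v i)) (i / S) σ) (hJ : T.ancestor v j ∈ J) :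
    missProb G M p (robustFASTBC T S c L) (2 * (c * S * (σ + 1))) k J v ≤
      2 * (pathPotential T c S lam v i * Real.exp (-(3 * (lam * (2 * (c * S) : ℕ))))) *
        Real.exp (-(lam * k)) := by
  have hP := two_le_pathPotential (T := T) (c := c) (S := S) (v := v) (i := i) h.pos.le
  have hx := h.rate_mul_superround_le
    ((T.one_le_rank v).trans (T.rank_le_maxRank v))
  rcases hj.eq_or_lt with rfl | hjd
  · rw [T.ancestor_level] at hJ
    exact (missProb_le_zero_of_mem hJ).trans (by positivity)
  rcases (T.antitone_rank_ancestor (v := v) (Nat.le_succ j)).lt_or_eq with hdrop | hsame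
  · have hhalf : 1 / 2 ≤ Real.exp (-(3 * (lam * (2 * (c * S) : ℕ)))) := by
      linarith [Real.add_one_le_exp (-(3 * (lam * (2 * (c * S) : ℕ))))]
    have hpot : pathPotential T c S lam v j ≤ pathPotential T c S lam v i := by
      simpa using sixteen_pow_mul_pathPotential_le (a := 0) h.pos.le hij hrank.le
    refine (hk.slow j hjd hdrop _ J hJ).trans ?_
    gcongr
    nlinarith
  · have hS : 0 < S := Nat.pos_of_mul_pos_left h.superround_pos
    have hblock : j / S = i / S + 1 := by
      rw [hend hjd hsame, Nat.mul_div_cancel _ hS]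
    refine (hk.aligned j hjd hsame (σ + 1) ?_ J hJ).trans_eq ?_
    · rw [hrank, hblock]
      exact hact.succ
    · rw [pathPotential_eq_of_next_block hj hblock hrank]

theorem PathBounds.aligned_step (hG : G.Connected) (hT : T.IsGBST)
    (h : IsRate p T.maxRank S c L lam) (hk : PathBounds T M p S c L lam v k)
    (hi : i < level G s v) (hfast : T.rank (T.ancestor v (i + 1)) = T.rank (T.ancestor v i))
    (hact : IsActive T.maxRank (T.rank (T.ancestor v i)) (i / S) σ) (hJ : T.ancestor v i ∈ J) :
    missProb G M p (robustFASTBC T S c L) (2 * (c * S * σ)) (2 * (c * S) + k) J v ≤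
      2 * pathPotential T c S lam v i * Real.exp (-(lam * (2 * (c * S) + k : ℕ))) := by
  have hS : 0 < S := Nat.pos_of_mul_pos_left h.superround_pos
  obtain ⟨j, hij, hj, hjS, hrank, hend⟩ := exists_maximal_constant_stretch
    (fun e => T.rank (T.ancestor v e)) hi
    ((Nat.lt_mul_div_succ i hS).trans_eq (Nat.mul_comm _ _)) hfast
  set x := lam * (2 * (c * S) : ℕ) with hx
  set P := pathPotential T c S lam v i
  set E := Real.exp (-(lam * k))
  have hx0 : 0 ≤ x := mul_nonneg h.pos.le (Nat.cast_nonneg _)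
  have hx1 : x ≤ 1 / 16 := h.rate_mul_superround_le
    ((T.one_le_rank v).trans (T.rank_le_maxRank v))
  have hexp : Real.exp (-(3 * x)) ≤ 1 := Real.exp_le_one_iff.2 (by linarith)
  have hPE : 0 < P * E :=
    mul_pos (zero_lt_two.trans_le (two_le_pathPotential h.pos.le)) (Real.exp_pos _)
  have hstep := missProb_add_le_of_missProb_le (x := v) (b := k) (T.ancestor v j)
    (y := 2 * (P * Real.exp (-(3 * x))) * E) (z := 4 * P * E) (r := x / 4) (by nlinarith)
    (fun J' hJJ' => hk.all i hi.le _ J' (hJJ' hJ))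
    (fun J' _ hmem => by
      rw [show 2 * (c * S * σ) + 2 * (c * S) = 2 * (c * S * (σ + 1)) by ring]
      exact hk.missProb_le_of_stretch_end_mem h hij.le hj hrank hend hact hmem)
    ((missProb_superround_le hG hT h hij.le hj hjS hrank hact hJ).trans_eq
      (by rw [hx]; push_cast; ring))
  refine hstep.trans ?_
  rw [exp_neg_mul_add, ← hx]
  have hloss := mul_le_mul_of_nonneg_left (exp_neg_three_mul_add_half_le hx0 hx1) hPE.le
  have hadvance : 0 ≤ P * E * Real.exp (-(3 * x)) * x :=
    mul_nonneg (mul_nonneg hPE.le (Real.exp_pos _).le) hx0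
  linarith

theorem PathBounds.waiting_step (h : IsRate p T.maxRank S c L lam)
    (hk : PathBounds T M p S c L lam v k) (hi : i < level G s v)
    (hfast : T.rank (T.ancestor v (i + 1)) = T.rank (T.ancestor v i))
    (hact : IsActive T.maxRank (T.rank (T.ancestor v i)) (i / S) σ) (hJ : T.ancestor v i ∈ J)
    {a : ℕ} (hta : t + a = 2 * (c * S * σ)) (ha : a ≤ 12 * T.maxRank * (c * S) + 4 * L) :
    missProb G M p (robustFASTBC T S c L) t (a + k) J v ≤
      4 * pathPotential T c S lam v i * Real.exp (-(lam * (a + k : ℕ))) := by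
  have hp : (0 : ℝ) ≤ p := p.2.1
  have hPE : 0 < pathPotential T c S lam v i * Real.exp (-(lam * k)) :=
    mul_pos (zero_lt_two.trans_le (two_le_pathPotential h.pos.le)) (Real.exp_pos _)
  refine missProb_add_le fun J' hJJ' => ?_
  rw [hta]
  refine (hk.aligned i hi hfast σ hact J' (hJJ' hJ)).trans ?_
  rw [exp_neg_mul_add]
  nlinarith [mul_le_mul_of_nonneg_left (h.one_sub_le_exp ha) hPE.le]

theorem pathBounds (hG : G.Connected) (hT : T.IsGBST) (hL : Fintype.card V ≤ 2 ^ L)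
    (h : IsRate p T.maxRank S c L lam) (k : ℕ) : PathBounds T M p S c L lam v k := by
  have hR : 1 ≤ T.maxRank := (T.one_le_rank v).trans (T.rank_le_maxRank v)
  have hcS := h.superround_pos
  have hWcS : 2 * (c * S) ≤ 12 * T.maxRank * (c * S) + 4 * L := two_mul_le_period hR _ _
  induction k using Nat.strong_induction_on with
  | _ k ih =>
  rcases le_total k (12 * T.maxRank * (c * S) + 4 * L) with hk | hk
  · exact .of_le_period h hk
  have hslow : ∀ i < level G s v, T.rank (T.ancestor v (i + 1)) < T.rank (T.ancestor v i) →
      ∀ t J, T.ancestor v i ∈ J → missProb G M p (robustFASTBC T S c L) t k J v ≤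
        pathPotential T c S lam v i * Real.exp (-(lam * k)) := by
    intro i hi hdrop t J hJ
    obtain ⟨k', rfl⟩ := Nat.exists_eq_add_of_le hk
    exact (ih k' (by omega)).slow_step h hL hi hdrop hJ
  refine ⟨fun i hi t J hJ => ?_, hslow, fun i hi hfast σ hact J hJ => ?_⟩
  · have hP := two_le_pathPotential (T := T) (c := c) (S := S) (v := v) (i := i) h.pos.le
    rcases hi.eq_or_lt with rfl | hid
    · rw [T.ancestor_level] at hJ
      exact (missProb_le_zero_of_mem hJ).trans (by positivity)
    rcases (T.antitone_rank_ancestor (v := v) (Nat.le_succ i)).lt_or_eq with hdrop | hfast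
    · refine (hslow i hid hdrop t J hJ).trans ?_
      gcongr
      linarith
    · obtain ⟨σ, a, hta, ha, haR, hact⟩ :=
        exists_isActive_start hR hcS (T.rank (T.ancestor v i)) (i / S) t
      obtain ⟨k', rfl⟩ := Nat.exists_eq_add_of_le ((haR.trans (Nat.le_add_right _ _)).trans hk)
      exact (ih k' (by omega)).waiting_step h hid hfast hact hJ hta
        (haR.trans (Nat.le_add_right _ _))
  · obtain ⟨k', rfl⟩ := Nat.exists_eq_add_of_le (hWcS.trans hk)
    exact (ih k' (by omega)).aligned_step hG hT h hi hfast hact hJ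

end Potential

section Rate

theorem one_lt_log {n : ℕ} (hn : 3 ≤ n) : 1 < Real.log n := by
  rw [Real.lt_log_iff_exp_lt (by positivity)]
  have : (3 : ℝ) ≤ n := by exact_mod_cast hn
  linarith [Real.exp_one_lt_d9]

theorem exists_forall_le_of_isBigO {f g : ℕ → ℝ} (h : f =O[atTop] g) :
    ∃ K : ℝ, 0 < K ∧ ∀ n, 0 < g n → f n ≤ K * g n := by
  obtain ⟨K, hK, hle⟩ := bound_of_isBigO_nat_atTop h
  refine ⟨K, hK, fun n hn => (Real.le_norm_self _).trans ?_⟩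
  simpa only [Real.norm_of_nonneg hn.le] using hle hn.ne'

theorem exists_superround_multiplier {ρ K κ : ℝ} (hρ0 : 0 ≤ ρ) (hρ1 : ρ < 1) (hκ0 : 0 < κ)
    (hκ1 : κ ≤ 1) :
    ∃ c₀ : ℕ, 1 ≤ c₀ ∧ ∀ c : ℕ, c₀ ≤ c → ∀ S : ℕ, 1 ≤ S →
      2 ^ S * ρ ^ ((c * S - 1) / 3) * Real.exp (K * S) ≤ κ := by
  obtain ⟨h, hh⟩ := exists_pow_lt_of_lt_one (show 0 < κ / (2 * Real.exp K) by positivity) hρ1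
  refine ⟨3 * h + 1, by omega, fun c hc S hS => ?_⟩
  have hexponent : h * S ≤ (c * S - 1) / 3 := by
    have hmul : (3 * h + 1) * S ≤ c * S := Nat.mul_le_mul_right _ hc
    rw [add_mul, mul_assoc, one_mul] at hmul
    omega
  have hbase : 2 * Real.exp K * ρ ^ h ≤ κ := by
    rw [lt_div_iff₀ (by positivity)] at hh
    linarith
  calc 2 ^ S * ρ ^ ((c * S - 1) / 3) * Real.exp (K * S)
      ≤ 2 ^ S * ρ ^ (h * S) * Real.exp (K * S) := by
        have := pow_le_pow_of_le_one hρ0 hρ1.le hexponent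
        gcongr
    _ = (2 * Real.exp K * ρ ^ h) ^ S := by
        rw [mul_comm K, Real.exp_nat_mul, pow_mul, mul_pow, mul_pow]
        ring
    _ ≤ κ ^ S := by gcongr
    _ ≤ κ := pow_le_of_le_one hκ0.le hκ1 (by omega)

theorem period_le_mul_superround {R S c L : ℕ} {ℓ K : ℝ} (hcS : 1 ≤ c * S) (hR : (R : ℝ) ≤ 3 * ℓ)
    (hL : (L : ℝ) ≤ K * ℓ) :
    ((12 * R * (c * S) + 4 * L : ℕ) : ℝ) ≤ (36 + 4 * K) * ℓ * (c * S : ℕ) := by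
  have hcS' : (1 : ℝ) ≤ (c * S : ℕ) := by exact_mod_cast hcS
  have hKℓ : 0 ≤ K * ℓ := (Nat.cast_nonneg L).trans hL
  have hLcS : (L : ℝ) ≤ K * ℓ * (c * S : ℕ) := hL.trans (le_mul_of_one_le_right hKℓ hcS')
  have hRcS : (R : ℝ) * (c * S : ℕ) ≤ 3 * ℓ * (c * S : ℕ) :=
    mul_le_mul_of_nonneg_right hR (Nat.cast_nonneg _)
  calc ((12 * R * (c * S) + 4 * L : ℕ) : ℝ) = 12 * (R * (c * S : ℕ)) + 4 * L := by
        push_cast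
        ring
    _ ≤ 12 * (3 * ℓ * (c * S : ℕ)) + 4 * (K * ℓ * (c * S : ℕ)) := by linarith
    _ = (36 + 4 * K) * ℓ * (c * S : ℕ) := by ring

theorem isRate_of_superround_le {p : unitInterval} {R S c L : ℕ} {ℓ K : ℝ}
    (hR1 : 1 ≤ R) (hcS : 1 ≤ c * S) (hR : (R : ℝ) ≤ 3 * ℓ) (hL : (L : ℝ) ≤ K * ℓ)
    (hfail : 2 ^ S * ((1 + (p : ℝ)) / 2) ^ ((c * S - 1) / 3) * ((36 + 4 * K) * ℓ) ≤
      (1 - p) / 128) :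
    IsRate p R S c L ((1 - p) / 64 / (12 * R * (c * S) + 4 * L : ℕ)) := by
  have hp0 : (0 : ℝ) ≤ p := p.2.1
  have hW : (0 : ℝ) < (12 * R * (c * S) + 4 * L : ℕ) := Nat.cast_pos.2 (by positivity)
  refine ⟨(div_mul_cancel₀ _ hW.ne').le, ?_⟩
  rw [div_mul_eq_mul_div, div_div, mul_comm _ (2 : ℝ), ← div_div, le_div_iff₀ hW]
  set q : ℝ := 2 ^ S * ((1 + (p : ℝ)) / 2) ^ ((c * S - 1) / 3)
  calc q * (12 * R * (c * S) + 4 * L : ℕ) ≤ q * ((36 + 4 * K) * ℓ * (c * S : ℕ)) :=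
        mul_le_mul_of_nonneg_left (period_le_mul_superround hcS hR hL) (by positivity)
    _ = q * ((36 + 4 * K) * ℓ) * (c * S : ℕ) := by ring
    _ ≤ (1 - p) / 128 * (c * S : ℕ) := mul_le_mul_of_nonneg_right hfail (Nat.cast_nonneg _)
    _ = (1 - p) / 64 * (c * S : ℕ) / 2 := by ring

theorem exists_isRate {p : unitInterval} (hp : p < 1) {S L : ℕ → ℕ} (hS_pos : ∀ n, 1 ≤ S n)
    (hS : (fun n => (S n : ℝ)) =Θ[atTop] fun n : ℕ => Real.log (Real.log n))
    (hL : (fun n => (L n : ℝ)) =O[atTop] fun n : ℕ => Real.log n) :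
    ∃ c₀ : ℕ, ∀ c : ℕ, c₀ ≤ c → ∃ A : ℝ, 0 < A ∧ ∀ n R : ℕ, 3 ≤ n → 1 ≤ R →
      (R : ℝ) ≤ 3 * Real.log n → ∃ lam, IsRate p R (S n) c (L n) lam ∧
        1 ≤ A * lam * (Real.log n * Real.log (Real.log n)) := by
  have hp0 : (0 : ℝ) ≤ p := p.2.1
  have hp1 : (p : ℝ) < 1 := hp
  obtain ⟨K₁, hK₁, hS_le⟩ := exists_forall_le_of_isBigO hS.1
  obtain ⟨K₂, hK₂, hL_le⟩ := exists_forall_le_of_isBigO hL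
  obtain ⟨K₃, -, hS_ge⟩ := exists_forall_le_of_isBigO hS.2
  obtain ⟨c₀, hc₀, hmult⟩ := exists_superround_multiplier (ρ := (1 + p) / 2) (K := K₃)
    (κ := (1 - p) / 128 / (36 + 4 * K₂)) (by linarith) (by linarith)
    (div_pos (by linarith) (by linarith)) ((div_le_one (by linarith)).2 (by linarith))
  refine ⟨c₀, fun c hc => ⟨(36 + 4 * K₂) * c * K₁ / ((1 - p) / 64), ?_, ?_⟩⟩
  · have hc1 : (0 : ℝ) < c := Nat.cast_pos.2 (hc₀.trans hc)
    exact div_pos (by positivity) (by linarith)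
  intro n R hn hR1 hR
  have hlog : 0 < Real.log n := zero_lt_one.trans (one_lt_log hn)
  have hcS : 1 ≤ c * S n := Nat.mul_pos (hc₀.trans hc) (hS_pos n)
  have hlog_le : Real.log n ≤ Real.exp (K₃ * S n) :=
    (Real.log_le_iff_le_exp hlog).1 (hS_ge n (Nat.cast_pos.2 (hS_pos n)))
  have hfail := hmult c hc (S n) (hS_pos n)
  rw [le_div_iff₀ (by linarith)] at hfail
  refine ⟨_, isRate_of_superround_le hR1 hcS hR (hL_le n hlog) (le_trans ?_ hfail), ?_⟩
  · rw [mul_comm (36 + 4 * K₂), ← mul_assoc]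
    gcongr
  · have hperiod := period_le_mul_superround hcS hR (hL_le n hlog)
    have hW : (0 : ℝ) < (12 * R * (c * S n) + 4 * L n : ℕ) := Nat.cast_pos.2 (by positivity)
    have hε : 0 < (1 - (p : ℝ)) / 64 := by linarith
    rw [← mul_div_assoc, div_mul_cancel₀ _ hε.ne', div_mul_eq_mul_div, le_div_iff₀ hW, one_mul]
    calc ((12 * R * (c * S n) + 4 * L n : ℕ) : ℝ)
        ≤ (36 + 4 * K₂) * Real.log n * (c * S n : ℕ) := hperiod
      _ = (36 + 4 * K₂) * c * Real.log n * S n := by push_cast; ring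
      _ ≤ (36 + 4 * K₂) * c * Real.log n * (K₁ * Real.log (Real.log n)) :=
          mul_le_mul_of_nonneg_left (hS_le n (Real.log_pos (one_lt_log hn))) (by positivity)
      _ = (36 + 4 * K₂) * c * K₁ * (Real.log n * Real.log (Real.log n)) := by ring

end Rate

section Main

variable {V : Type*} [Fintype V] {G : SimpleGraph V} {s : V} {T : RankedBFSTree G s}

theorem maxRank_le_three_mul_log (T : RankedBFSTree G s) (hn : 3 ≤ Fintype.card V) :
    (T.maxRank : ℝ) ≤ 3 * Real.log (Fintype.card V) := by
  have hpow : (2 : ℝ) ^ (T.maxRank - 1) ≤ Fintype.card V := by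
    exact_mod_cast T.two_pow_maxRank_le_card
  have hlog := Real.log_le_log (by positivity) hpow
  rw [Real.log_pow] at hlog
  have hpred : (T.maxRank : ℝ) ≤ (T.maxRank - 1 : ℕ) + 1 := by exact_mod_cast (by omega)
  nlinarith [Real.log_two_gt_d9, one_lt_log hn, Nat.cast_nonneg (α := ℝ) (T.maxRank - 1)]

theorem sixteen_pow_maxRank_le (T : RankedBFSTree G s) :
    (16 : ℝ) ^ T.maxRank ≤ 16 * (Fintype.card V : ℝ) ^ 4 := by
  have hpow : (2 : ℝ) ^ (T.maxRank - 1) ≤ Fintype.card V := by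
    exact_mod_cast T.two_pow_maxRank_le_card
  calc (16 : ℝ) ^ T.maxRank ≤ 16 ^ (T.maxRank - 1 + 1) :=
        pow_le_pow_right₀ (by norm_num) (by omega)
    _ = 16 * (2 ^ (T.maxRank - 1)) ^ 4 := by
        rw [pow_succ, ← pow_mul, mul_comm (T.maxRank - 1) 4, pow_mul]
        norm_num
        ring
    _ ≤ 16 * (Fintype.card V : ℝ) ^ 4 := by gcongr

variable {S c L : ℕ} {lam : ℝ}

theorem four_mul_pathPotential_zero_le (hG : G.Connected) (hn : 3 ≤ Fintype.card V)
    (hlam : 0 ≤ lam) (v : V) :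
    4 * pathPotential T c S lam v 0 ≤
      (Fintype.card V : ℝ) ^ 9 * Real.exp (6 * c * lam * G.diam) := by
  have hn' : (3 : ℝ) ≤ Fintype.card V := by exact_mod_cast hn
  have hdiam : level G s v ≤ G.diam := by
    have : Nonempty V := ⟨s⟩
    exact SimpleGraph.dist_le_diam (SimpleGraph.connected_iff_ediam_ne_top.1 hG)
  have hblocks : ((level G s v / S : ℕ) : ℝ) * S ≤ G.diam := by
    exact_mod_cast (Nat.div_mul_le_self _ S).trans hdiam
  have hexp : Real.exp (3 * (lam * (2 * (c * S) : ℕ))) ^ (level G s v / S - 0 / S) ≤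
      Real.exp (6 * c * lam * G.diam) := by
    rw [Nat.zero_div, Nat.sub_zero, ← Real.exp_nat_mul, Real.exp_le_exp]
    calc ((level G s v / S : ℕ) : ℝ) * (3 * (lam * (2 * (c * S) : ℕ)))
        = 6 * c * lam * ((level G s v / S : ℕ) * S) := by push_cast; ring
      _ ≤ 6 * c * lam * G.diam := by gcongr
  have hrank : (16 : ℝ) ^ T.rank (T.ancestor v 0) ≤ 16 * (Fintype.card V : ℝ) ^ 4 :=
    (pow_le_pow_right₀ (by norm_num) (T.rank_le_maxRank _)).trans (sixteen_pow_maxRank_le T)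
  have hpow : (3 : ℝ) ^ 5 ≤ (Fintype.card V : ℝ) ^ 5 := by gcongr
  calc 4 * pathPotential T c S lam v 0
      = 8 * 16 ^ T.rank (T.ancestor v 0) *
          Real.exp (3 * (lam * (2 * (c * S) : ℕ))) ^ (level G s v / S - 0 / S) := by
        rw [pathPotential]
        ring
    _ ≤ 8 * (16 * (Fintype.card V : ℝ) ^ 4) * Real.exp (6 * c * lam * G.diam) := by gcongr
    _ = 128 * (Fintype.card V : ℝ) ^ 4 * Real.exp (6 * c * lam * G.diam) := by ring
    _ ≤ (Fintype.card V : ℝ) ^ 5 * (Fintype.card V : ℝ) ^ 4 *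
          Real.exp (6 * c * lam * G.diam) := by
        gcongr
        linarith
    _ = (Fintype.card V : ℝ) ^ 9 * Real.exp (6 * c * lam * G.diam) := by ring

theorem failureProb_robustFASTBC_le (hG : G.Connected) (hT : T.IsGBST)
    (hn : 3 ≤ Fintype.card V) (M : FaultModel) {p : unitInterval}
    (hL : Fintype.card V ≤ 2 ^ L) (h : IsRate p T.maxRank S c L lam) {δ : ℝ} (hδ : 0 < δ) {N : ℕ}
    (hN : 10 * Real.log (Fintype.card V) + 6 * c * lam * G.diam + Real.log (1 / δ) ≤ lam * N) :
    failureProb G M p (robustFASTBC T S c L) s N ≤ ENNReal.ofReal δ := by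
  set n := Fintype.card V
  have hn0 : (0 : ℝ) < n := Nat.cast_pos.2 (by omega)
  have hmiss (v : V) : missProb G M p (robustFASTBC T S c L) 0 N {s} v ≤
      n ^ 9 * Real.exp (6 * c * lam * G.diam) * Real.exp (-(lam * N)) := by
    have hroot : T.ancestor v 0 ∈ ({s} : Finset V) := by simp [T.ancestor_zero hG]
    refine ((pathBounds hG hT hL h N).all 0 (Nat.zero_le _) 0 {s} hroot).trans ?_
    exact mul_le_mul_of_nonneg_right (four_mul_pathPotential_zero_le hG hn h.pos.le v)
      (Real.exp_pos _).le
  have hpow : Real.exp (10 * Real.log n) = (n : ℝ) ^ 10 := by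
    rw [mul_comm, Real.exp_mul, Real.exp_log hn0]
    norm_cast
  have hunion : n * (n ^ 9 * Real.exp (6 * c * lam * G.diam) * Real.exp (-(lam * N))) ≤ δ :=
    calc n * (n ^ 9 * Real.exp (6 * c * lam * G.diam) * Real.exp (-(lam * N)))
        = (n : ℝ) ^ 10 * Real.exp (6 * c * lam * G.diam) * Real.exp (-(lam * N)) := by ring
      _ = Real.exp (10 * Real.log n + 6 * c * lam * G.diam + -(lam * N)) := by
          rw [Real.exp_add, Real.exp_add, hpow]
      _ ≤ Real.exp (-Real.log (1 / δ)) := Real.exp_le_exp.2 (by linarith)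
      _ = δ := by rw [one_div, Real.log_inv, neg_neg, Real.exp_log hδ]
  calc failureProb G M p (robustFASTBC T S c L) s N
      ≤ ∑ v, ENNReal.ofReal (missProb G M p (robustFASTBC T S c L) 0 N {s} v) :=
        failureProb_le_sum_missProb s N
    _ ≤ ∑ _v : V, ENNReal.ofReal
          (n ^ 9 * Real.exp (6 * c * lam * G.diam) * Real.exp (-(lam * N))) :=
        Finset.sum_le_sum fun v _ => ENNReal.ofReal_le_ofReal (hmiss v)
    _ = ENNReal.ofReal
          (n * (n ^ 9 * Real.exp (6 * c * lam * G.diam) * Real.exp (-(lam * N)))) := by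
        rw [Finset.sum_const, Finset.card_univ, ← ENNReal.ofReal_nsmul, nsmul_eq_mul]
    _ ≤ ENNReal.ofReal δ := ENNReal.ofReal_le_ofReal hunion

theorem rate_mul_rounds_ge {A D x ℓ y N : ℝ} {c : ℕ} (hlam : 0 ≤ lam) (hA : 0 ≤ A) (hD : 0 ≤ D)
    (hx : 0 ≤ x) (hℓ : 0 ≤ ℓ) (hy : 0 ≤ y) (hAx : 1 ≤ A * lam * x)
    (hN : (6 * c + 10 * A) * (D + x * (ℓ + y)) ≤ N) :
    10 * ℓ + 6 * c * lam * D + y ≤ lam * N :=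
  calc 10 * ℓ + 6 * c * lam * D + y ≤ 6 * c * lam * D + 10 * (1 * (ℓ + y)) := by linarith
    _ ≤ 6 * c * lam * D + 10 * (A * lam * x * (ℓ + y)) := by gcongr
    _ ≤ 6 * c * lam * D + 10 * (A * lam * x * (ℓ + y)) +
          (6 * c * lam * (x * (ℓ + y)) + 10 * A * lam * D) := le_add_of_nonneg_right (by positivity)
    _ = lam * ((6 * c + 10 * A) * (D + x * (ℓ + y))) := by ring
    _ ≤ lam * N := mul_le_mul_of_nonneg_left hN hlam

end Main

end

end NoisyRadio

open NoisyRadio in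
theorem mainTheorem3 (p : unitInterval) (hp : p < 1)
    (S L : ℕ → ℕ)
    (hS_pos : ∀ n, 1 ≤ S n)
    (hS : (fun n => (S n : ℝ)) =Θ[atTop] fun n : ℕ => Real.log (Real.log (n : ℝ)))
    (hL_large : ∀ n, Nat.clog 2 n ≤ L n)
    (hL : (fun n => (L n : ℝ)) =O[atTop] fun n : ℕ => Real.log (n : ℝ)) :
    ∃ c₀ : ℕ, ∀ c : ℕ, c₀ ≤ c → ∃ C : ℝ, 0 < C ∧
      ∀ (V : Type*) [Fintype V] (G : SimpleGraph V) (s : V), G.Connected → 3 ≤ Fintype.card V →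
        (∃ T : NoisyRadio.RankedBFSTree G s, T.IsGBST) ∧
        ∀ T : NoisyRadio.RankedBFSTree G s, T.IsGBST →
          ∀ (M : NoisyRadio.FaultModel) (δ : ℝ), 0 < δ → δ < 1 →
            ∀ N : ℕ,
              C * ((G.diam : ℝ) + Real.log (Fintype.card V) * Real.log (Real.log (Fintype.card V)) *
                (Real.log (Fintype.card V) + Real.log (1 / δ))) ≤ (N : ℝ) →
              NoisyRadio.failureProb G M p
                (NoisyRadio.robustFASTBC T (S (Fintype.card V)) c (L (Fintype.card V))) s N
                  ≤ ENNReal.ofReal δ := by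
  obtain ⟨c₀, hrate⟩ := exists_isRate hp hS_pos hS hL
  refine ⟨c₀, fun c hc => ?_⟩
  obtain ⟨A, hA, hrate⟩ := hrate c hc
  refine ⟨6 * c + 10 * A, by positivity, fun V _ G s hG hn => ⟨RankedBFSTree.exists_isGBST hG, ?_⟩⟩
  intro T hT M δ hδ hδ1 N hN
  have hcard : Fintype.card V ≤ 2 ^ L (Fintype.card V) :=
    (Nat.le_pow_clog one_lt_two _).trans (Nat.pow_le_pow_right two_pos (hL_large _))
  obtain ⟨lam, hlam, hAlam⟩ := hrate (Fintype.card V) T.maxRank hn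
    ((T.one_le_rank s).trans (T.rank_le_maxRank s)) (maxRank_le_three_mul_log T hn)
  have hlog := one_lt_log hn
  have hlogδ : 0 ≤ Real.log (1 / δ) := Real.log_nonneg ((one_le_div hδ).2 hδ1.le)
  refine failureProb_robustFASTBC_le hG hT hn M hcard hlam hδ ?_
  exact rate_mul_rounds_ge hlam.pos.le hA.le (Nat.cast_nonneg _)
    (mul_nonneg (by linarith) (Real.log_pos hlog).le) (by linarith) hlogδ hAlam hN
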